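/- Let $(X,d,\mu)$ be a complete metric space with a Borel measure such that $0<\mu(B)<\infty$ for all balls $B$ and $\mu$ is doubling. Let $1\le p<\infty$ and assume that $X$ supports a $p$-Poincaré inequality, i.e. there are $C>0$ and $\lambda\ge1$ such that $$\frac1{\mu(B)}\int_B|u-u_B|\,d\mu\le C\operatorname{diam}(B)\Bigl(\frac1{\mu(\lambda B)}\int_{\lambda B}g^p\,d\mu\Bigr)^{1/p},\qquad u_B=\frac1{\mu(B)}\int_B u\,d\mu,$$ for all balls $B$, all $u$ in the Newtonian space $N^{1,p}(X)$ and all upper gradients $g$ of $u$. Let $\Omega\subsetneq X$ be a bounded nonempty connected open set. *Ends and prime ends.* A bounded connected set $E\subsetneq\Omega$ is acceptable if $\overline E\cap\partial\Omega\ne\emptyset$. A chain is a sequence $\{E_k\}_{k=1}^\infty$ of acceptable sets such that, for all $k$, $E_{k+1}\subset E_k$ and $\operatorname{dist}(\Omega\cap\partial E_{k+1},\Omega\cap\partial E_k)>0$, and such that the impression $\bigcap_k\overline{E_k}$ is contained in $\partial\Omega$. A chain $\{E_k\}$ divides a chain $\{F_k\}$ if for each $k$ there is $l$ with $E_l\subset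 F_k$; two chains are equivalent if they divide each other, and an end is an equivalence class of chains. Impressions and division pass to ends. A prime end is an end that is not divisible by any other end; the set of all prime ends is $\partial_P\Omega$. *$\mathrm{Mod}_p$-prime ends.* The $p$-modulus of a family $\Gamma$ of nonconstant rectifiable curves is $\mathrm{Mod}_p(\Gamma)=\inf_\rho\int_X\rho^p\,d\mu$, the infimum being over all nonnegative Borel functions $\rho$ with $\int_\gamma\rho\,ds\ge1$ for all $\gamma\in\Gamma$; and $\mathrm{Mod}_p(E,F,\Omega)$ is the $p$-modulus of the family of nonconstant rectifiable curves in $\Omega$ starting in $E$ and ending in $F$. A $\mathrm{Mod}_p$-end is an end represented by a chain $\{E_k\}$ with $\lim_{k\to\infty}\mathrm{Mod}_p(E_k,K,\Omega)=0$ for every compact $K\subset\Omega$. A $\mathrm{Mod}_p$-prime end is a $\mathrm{Mod}_p$-end that is not divisible by any other $\mathrm{Mod}_p$-end. *Further notions.* A point $x\in\partial\Omega$ is accessible if there is a (continuous, possibly nonrectifiable) curve $\gamma:[0,1]\to X$ with $\gamma(1)=x$ and $\gamma([0,1))\subset\Omega$. The set $\Omega$ is finitely connected at the boundary if for every $x\in\partial\Omega$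 and every $r>0$ there is an open set $G\subset X$ with $x\in G\subset B(x,r)$ such that $G\cap\Omega$ has only finitely many components. For $x\in X$, $Q(x)$ is the set of all $q>0$ for which there are constants $C_q,R_q>0$ such that $\mu(B(x,r))/\mu(B(x,R))\le C_q(r/R)^q$ for all $0<r\le R\le R_q$. **Theorem.** Assume that $\Omega$ is finitely connected at the boundary. Then the impression of every prime end is a singleton. Moreover, for every $x\in\partial\Omega$ there is a prime end with impression $\{x\}$, and $x$ is accessible. If furthermore $p\in Q(x)\ne(0,1]$ for every $x\in\partial\Omega$, then $\partial_P\Omega$ is equal to the set of all $\mathrm{Mod}_p$-prime ends of $\Omega$. -/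

import Mathlib

open Set Metric MeasureTheory Filter Topology
open scoped ENNReal

namespace PrimeEnds

/-! ### Rectifiable curves, upper gradients, modulus, Poincaré inequality -/

section Curves

variable {X : Type*} [MetricSpace X]

/-- A nonconstant rectifiable curve `γ : [0, l] → X`, parameterized by arc length. Only the values
of `toFun` on `[0, l]` are ever used. -/
structure RectCurve (X : Type*) [MetricSpace X] where
  /-- the length of the curve -/
  length : ℝ
  length_pos : 0 < length
  toFun : ℝ → X
  unitSpeed : HasUnitSpeedOn toFun (Icc 0 length)

/-- The starting point of a curve. -/
def RectCurve.source (γ : RectCurve X) : X := γ.toFun 0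

/-- The end point of a curve. -/
def RectCurve.target (γ : RectCurve X) : X := γ.toFun γ.length

/-- The arc length integral `∫_γ g ds` of a nonnegative function. -/
noncomputable def RectCurve.integral (γ : RectCurve X) (g : X → ℝ≥0∞) : ℝ≥0∞ :=
  ∫⁻ t in Icc 0 γ.length, g (γ.toFun t)

/-- The family `Γ(E, F, U)` of all nonconstant rectifiable curves in `U` starting in `E` and ending
in `F`. -/
def curveFamily (E F U : Set X) : Set (RectCurve X) :=
  {γ | (∀ t ∈ Icc 0 γ.length, γ.toFun t ∈ U) ∧ γ.source ∈ E ∧ γ.target ∈ F}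

variable [MeasurableSpace X]

/-- The `p`-modulus of a family of nonconstant rectifiable curves. -/
noncomputable def modulus (μ : Measure X) (p : ℝ) (Γ : Set (RectCurve X)) : ℝ≥0∞ :=
  ⨅ (ρ : X → ℝ≥0∞) (_ : Measurable ρ ∧ ∀ γ ∈ Γ, 1 ≤ γ.integral ρ), ∫⁻ x, ρ x ^ p ∂μ

/-- A nonnegative Borel function `g` is an upper gradient of the extended real-valued function `u`:
for every nonconstant rectifiable curve `γ` with end points `x` and `y`,
`|u x - u y| ≤ ∫_γ g ds` if both `u x` and `u y` are finite, and `∫_γ g ds = ∞` otherwise. -/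
def IsUpperGradient (g : X → ℝ≥0∞) (u : X → EReal) : Prop :=
  Measurable g ∧ ∀ γ : RectCurve X,
    ((u γ.source ≠ ⊤ ∧ u γ.source ≠ ⊥ ∧ u γ.target ≠ ⊤ ∧ u γ.target ≠ ⊥) →
      (u γ.source - u γ.target).abs ≤ γ.integral g) ∧
    (¬ (u γ.source ≠ ⊤ ∧ u γ.source ≠ ⊥ ∧ u γ.target ≠ ⊤ ∧ u γ.target ≠ ⊥) →
      γ.integral g = ⊤)

/-- The Newtonian (semi)norm `‖u‖_{N^{1,p}(X)}`. -/
noncomputable def newtonianNorm (μ : Measure X) (p : ℝ) (u : X → EReal) : ℝ≥0∞ :=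
  (∫⁻ x, (u x).abs ^ p ∂μ +
    ⨅ (g : X → ℝ≥0∞) (_ : IsUpperGradient g u), ∫⁻ x, g x ^ p ∂μ) ^ (1 / p)

/-- `u` (an everywhere defined, `μ`-measurable function) belongs to the Newtonian space
`N^{1,p}(X)`. -/
def MemNewtonian (μ : Measure X) (p : ℝ) (u : X → EReal) : Prop :=
  AEMeasurable u μ ∧ newtonianNorm μ p u < ⊤

/-- `X` supports a `p`-Poincaré inequality: there are `C > 0` and `lam ≥ 1` such that
`⨍_B |u - u_B| dμ ≤ C (diam B) (⨍_{lam B} g ^ p dμ) ^ (1 / p)` for all balls `B`, all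
`u ∈ N^{1,p}(X)` and all upper gradients `g` of `u`. (Functions in `N^{1,p}(X)` are finite almost
everywhere, so `toReal` is harmless under the integral sign.) -/
def SupportsPoincare (μ : Measure X) (p : ℝ) : Prop :=
  ∃ C lam : ℝ, 0 < C ∧ 1 ≤ lam ∧
    ∀ (x : X) (r : ℝ), 0 < r →
      ∀ u : X → EReal, MemNewtonian μ p u →
        ∀ g : X → ℝ≥0∞, IsUpperGradient g u →
          ⨍⁻ y in ball x r,
              ENNReal.ofReal |(u y).toReal - ⨍ z in ball x r, (u z).toReal ∂μ| ∂μ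
            ≤ ENNReal.ofReal (C * diam (ball x r)) *
                (⨍⁻ y in ball x (lam * r), g y ^ p ∂μ) ^ (1 / p)

/-- `μ` is a doubling measure. -/
def IsDoubling (μ : Measure X) : Prop :=
  ∃ C : ℝ, 0 < C ∧ ∀ (x : X) (r : ℝ), 0 < r →
    μ (ball x (2 * r)) ≤ ENNReal.ofReal C * μ (ball x r)

/-- The pointwise dimension set `Q(x)`: all `q > 0` for which there are `C, R₀ > 0` with
`μ(B(x,r)) / μ(B(x,R)) ≤ C (r / R) ^ q` whenever `0 < r ≤ R ≤ R₀`. -/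
def dimensionSet (μ : Measure X) (x : X) : Set ℝ :=
  {q | 0 < q ∧ ∃ C R₀ : ℝ, 0 < C ∧ 0 < R₀ ∧ ∀ r R : ℝ, 0 < r → r ≤ R → R ≤ R₀ →
    μ.real (ball x r) / μ.real (ball x R) ≤ C * (r / R) ^ q}

end Curves

/-! ### Chains, ends and prime ends -/

section Ends

variable {X : Type*} [MetricSpace X]

/-- `E` is an acceptable subset of `Ω`. -/
structure IsAcceptable (Ω E : Set X) : Prop where
  isBounded : Bornology.IsBounded E
  isConnected : IsConnected E
  ssubset : E ⊂ Ω
  meets_boundary : (closure E ∩ frontier Ω).Nonempty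

/-- A chain of acceptable subsets of `Ω`. The field `separated` says that the distance between
`Ω ∩ ∂E_{k+1}` and `Ω ∩ ∂E_k` is positive. -/
structure Chain (Ω : Set X) where
  sets : ℕ → Set X
  acceptable : ∀ k, IsAcceptable Ω (sets k)
  subset : ∀ k, sets (k + 1) ⊆ sets k
  separated : ∀ k, ∃ δ : ℝ, 0 < δ ∧
    ∀ x ∈ Ω ∩ frontier (sets (k + 1)), ∀ y ∈ Ω ∩ frontier (sets k), δ ≤ dist x y
  impression_subset : ⋂ k, closure (sets k) ⊆ frontier Ω

variable {Ω : Set X}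

/-- The impression of a chain. -/
def Chain.impression (c : Chain Ω) : Set X := ⋂ k, closure (c.sets k)

/-- The chain `c` divides the chain `d`. -/
def Chain.Divides (c d : Chain Ω) : Prop := ∀ k, ∃ l, c.sets l ⊆ d.sets k

theorem Chain.Divides.refl (c : Chain Ω) : c.Divides c := fun k => ⟨k, Subset.rfl⟩

theorem Chain.Divides.trans {c d e : Chain Ω} (h₁ : c.Divides d) (h₂ : d.Divides e) :
    c.Divides e := fun k => by
  obtain ⟨l, hl⟩ := h₂ k
  obtain ⟨m, hm⟩ := h₁ l
  exact ⟨m, hm.trans hl⟩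

theorem Chain.Divides.impression_subset {c d : Chain Ω} (h : c.Divides d) :
    c.impression ⊆ d.impression := by
  refine subset_iInter fun k => ?_
  obtain ⟨l, hl⟩ := h k
  exact (iInter_subset _ l).trans (closure_mono hl)

/-- Two chains are equivalent if they divide each other. -/
def Chain.Equivalent (c d : Chain Ω) : Prop := c.Divides d ∧ d.Divides c

/-- Equivalence of chains as a setoid. -/
def chainSetoid (Ω : Set X) : Setoid (Chain Ω) where
  r := Chain.Equivalent
  iseqv :=
    { refl := fun c => ⟨Chain.Divides.refl c, Chain.Divides.refl c⟩
      symm := fun h => ⟨h.2, h.1⟩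
      trans := fun h₁ h₂ => ⟨h₁.1.trans h₂.1, h₂.2.trans h₁.2⟩ }

/-- The ends of `Ω`, i.e. the equivalence classes of chains. As a type this is the end boundary. -/
def BoundaryEnd (Ω : Set X) : Type _ := Quotient (chainSetoid Ω)

/-- The end represented by a chain. -/
def Chain.toEnd (c : Chain Ω) : BoundaryEnd Ω := Quotient.mk (chainSetoid Ω) c

/-- The impression of an end is the impression of any representing chain. -/
def BoundaryEnd.impression (e : BoundaryEnd Ω) : Set X :=
  Quotient.lift Chain.impression
    (fun (c d : Chain Ω) (h : c.Equivalent d) => Subset.antisymm h.1.impression_subset h.2.impression_subset) e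

/-- Division of ends is division of any representing chains. -/
def BoundaryEnd.Divides (e f : BoundaryEnd Ω) : Prop :=
  Quotient.lift₂ Chain.Divides
    (fun (a b a' b' : Chain Ω) (h₁ : a.Equivalent a') (h₂ : b.Equivalent b') => propext
      ⟨fun h => h₁.2.trans (h.trans h₂.1), fun h => h₁.1.trans (h.trans h₂.2)⟩) e f

/-- A prime end is an end that is not divisible by any other end. -/
def BoundaryEnd.IsPrime (e : BoundaryEnd Ω) : Prop := ∀ f : BoundaryEnd Ω, f.Divides e → f = e

/-- The prime end boundary of `Ω`. -/
def primeEndBoundary (Ω : Set X) : Set (BoundaryEnd Ω) := {e | e.IsPrime}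

variable [MeasurableSpace X]

/-- A chain is a `Mod_p`-chain if `Mod_p(E_k, K, Ω) → 0` for every compact `K ⊆ Ω`. -/
def Chain.IsMod (μ : Measure X) (p : ℝ) (c : Chain Ω) : Prop :=
  ∀ K : Set X, IsCompact K → K ⊆ Ω →
    Tendsto (fun k => modulus μ p (curveFamily (c.sets k) K Ω)) atTop (𝓝 0)

/-- A `Mod_p`-end is an end represented by some `Mod_p`-chain. -/
def BoundaryEnd.IsMod (μ : Measure X) (p : ℝ) (e : BoundaryEnd Ω) : Prop :=
  ∃ c : Chain Ω, c.toEnd = e ∧ c.IsMod μ p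

/-- A `Mod_p`-prime end is a `Mod_p`-end that is not divisible by any other `Mod_p`-end. -/
def BoundaryEnd.IsModPrime (μ : Measure X) (p : ℝ) (e : BoundaryEnd Ω) : Prop :=
  e.IsMod μ p ∧ ∀ f : BoundaryEnd Ω, f.IsMod μ p → f.Divides e → f = e

/-- The `Mod_p`-prime end boundary of `Ω`. -/
def modPrimeEndBoundary (μ : Measure X) (p : ℝ) (Ω : Set X) : Set (BoundaryEnd Ω) :=
  {e | e.IsModPrime μ p}

end Ends

/-! ### Accessibility and finite connectedness at the boundary -/

section Boundary

variable {X : Type*} [MetricSpace X]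

/-- `x` is an accessible boundary point of `Ω`. -/
def IsAccessible (Ω : Set X) (x : X) : Prop :=
  x ∈ frontier Ω ∧ ∃ γ : ℝ → X, ContinuousOn γ (Icc 0 1) ∧ γ 1 = x ∧ ∀ t ∈ Ico (0 : ℝ) 1, γ t ∈ Ω

/-- `Ω` is finitely connected at `x`: arbitrarily small open neighborhoods `G` of `x` are such that
`G ∩ Ω` has only finitely many connected components. -/
def FinitelyConnectedAt (Ω : Set X) (x : X) : Prop :=
  ∀ r : ℝ, 0 < r → ∃ G : Set X, IsOpen G ∧ x ∈ G ∧ G ⊆ ball x r ∧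
    {A : Set X | ∃ y ∈ G ∩ Ω, A = connectedComponentIn (G ∩ Ω) y}.Finite

/-- `Ω` is finitely connected at the boundary. -/
def FinitelyConnectedAtBoundary (Ω : Set X) : Prop := ∀ x ∈ frontier Ω, FinitelyConnectedAt Ω x

end Boundary

end PrimeEnds

/-!
Let `𝒱` be an ultrafilter on `Ω` converging to `x ∈ ∂Ω`. If `Ω` is finitely connected at `x`, then
`𝒱` selects one component of `Ω` near `x` at every scale, and these components form a chain with
impression `{x}`. A chain with one-point impression divides every chain all of whose sets it keeps
meeting, because the relative boundaries of that chain are separated. Hence every end is divisible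
by an end with one-point impression, and the prime ends are exactly the ends with one-point
impression.

The Poincaré inequality enters through local path connectedness. Distances along `ε`-chains,
truncated near a point, have upper gradients bounded independently of `ε`, so by Campanato's
argument they are Lipschitz uniformly in `ε`; limits of short `ε`-chains as `ε → 0` are curves.

For the modulus, test with a weight that is constant on each of `N` dyadic annuli around `x` and
gives every curve crossing all of them length at least one. If `μ (B(x, r)) ≲ r ^ q`, its energy is
at most a multiple of `N ^ (1 - p)` when `q = p > 1`, and tends to zero with the radius when
`q > p`.
-/

namespace PrimeEnds

open scoped NNReal

section Doubling

variable {X : Type*} [MetricSpace X] [MeasurableSpace X] {μ : Measure X}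

theorem IsDoubling.exists_measure_ball_two_pow_mul_le (h : IsDoubling μ) :
    ∃ D : ℝ≥0, ∀ (n : ℕ) (x : X) (r : ℝ), 0 < r →
      μ (ball x (2 ^ n * r)) ≤ D ^ n * μ (ball x r) := by
  obtain ⟨D, -, hD⟩ := h
  refine ⟨D.toNNReal, fun n x r hr => ?_⟩
  induction n with
  | zero => simp
  | succ n ih =>
    calc μ (ball x (2 ^ (n + 1) * r)) = μ (ball x (2 * (2 ^ n * r))) := by ring_nf
      _ ≤ D.toNNReal * μ (ball x (2 ^ n * r)) := hD x _ (by positivity)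
      _ ≤ D.toNNReal * (D.toNNReal ^ n * μ (ball x r)) := by gcongr
      _ = D.toNNReal ^ (n + 1) * μ (ball x r) := by ring

theorem IsDoubling.measure_ball_lt_top [IsLocallyFiniteMeasure μ] (h : IsDoubling μ) (x : X)
    (r : ℝ) : μ (ball x r) < ∞ := by
  obtain ⟨D, hD⟩ := h.exists_measure_ball_two_pow_mul_le
  obtain ⟨δ, hδ, hfin⟩ := (μ.finiteAt_nhds x).exists_mem_basis nhds_basis_ball
  obtain ⟨n, hn⟩ := pow_unbounded_of_one_lt (r / δ) one_lt_two
  calc μ (ball x r) ≤ μ (ball x (2 ^ n * δ)) :=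
        measure_mono (ball_subset_ball ((div_lt_iff₀ hδ).1 hn).le)
    _ ≤ D ^ n * μ (ball x δ) := hD n x δ hδ
    _ < ∞ := ENNReal.mul_lt_top (by finiteness) hfin

theorem exists_seq_le_dist_of_not_totallyBounded {α : Type*} [PseudoMetricSpace α] {s : Set α}
    (hs : ¬ TotallyBounded s) :
    ∃ ε > 0, ∃ f : ℕ → α, (∀ n, f n ∈ s) ∧ Pairwise fun m n => ε ≤ dist (f m) (f n) := by
  simp only [Metric.totallyBounded_iff, not_forall, not_exists, not_and] at hs
  obtain ⟨ε, hε, hcover⟩ := hs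
  have : Std.Symm fun y z : α => ε ≤ dist y z := ⟨fun y z h => by rwa [dist_comm]⟩
  refine ⟨ε, hε, exists_seq_of_forall_finset_exists' (· ∈ s) (fun y z => ε ≤ dist y z)
    fun t _ => ?_⟩
  obtain ⟨y, hy, hyt⟩ := not_subset.1 (hcover t t.finite_toSet)
  refine ⟨y, hy, fun z hz => not_lt.1 fun hlt => hyt (mem_iUnion₂.2 ⟨z, hz, ?_⟩)⟩
  rwa [mem_ball, dist_comm]

theorem IsDoubling.totallyBounded_ball [OpensMeasurableSpace X] [μ.IsOpenPosMeasure]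
    [IsLocallyFiniteMeasure μ] (h : IsDoubling μ) (x : X) (R : ℝ) :
    TotallyBounded (ball x R) := by
  by_contra htb
  obtain ⟨ε, hε, f, hf, hsep⟩ := exists_seq_le_dist_of_not_totallyBounded htb
  have hR : 0 < R := pos_of_mem_ball (hf 0)
  obtain ⟨D, hD⟩ := h.exists_measure_ball_two_pow_mul_le
  obtain ⟨n, hn⟩ := pow_unbounded_of_one_lt (2 * R / (ε / 2)) one_lt_two
  rw [div_lt_iff₀ (by positivity)] at hn
  have hlarge : ∀ i, ball x R ⊆ ball (f i) (2 ^ n * (ε / 2)) := fun i =>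
    ball_subset_ball' (by linarith [mem_ball'.1 (hf i)])
  have hmeas : ∀ i, μ (ball x R) / D ^ n ≤ μ (ball (f i) (ε / 2)) := fun i =>
    ENNReal.div_le_of_le_mul' ((measure_mono (hlarge i)).trans (hD n _ _ (by positivity)))
  have hpos : 0 < μ (ball x R) / D ^ n :=
    ENNReal.div_pos (measure_ball_pos μ x hR).ne' (by finiteness)
  have hdisj : Pairwise (Function.onFun Disjoint fun i => ball (f i) (ε / 2)) := fun i j hij =>
    ball_disjoint_ball (by linarith [hsep hij])
  have hunion : μ (⋃ i, ball (f i) (ε / 2)) ≠ ∞ :=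
    ((measure_mono (iUnion_subset fun i => ball_subset_ball' (by gcongr; exact (hf i).le))).trans_lt
      (h.measure_ball_lt_top x (ε / 2 + R))).ne
  have hfinite := Measure.finite_const_le_meas_of_disjoint_iUnion μ
    hpos (fun _ => measurableSet_ball) hdisj hunion
  exact infinite_univ (hfinite.subset fun i _ => hmeas i)

theorem IsDoubling.properSpace [CompleteSpace X] [OpensMeasurableSpace X] [μ.IsOpenPosMeasure]
    [IsLocallyFiniteMeasure μ] (h : IsDoubling μ) : ProperSpace X :=
  ⟨fun x R => isCompact_iff_totallyBounded_isComplete.2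
    ⟨(h.totallyBounded_ball x (R + 1)).subset (closedBall_subset_ball (by linarith)),
      isClosed_closedBall.isComplete⟩⟩

theorem isOpenPosMeasure_of_ball_pos (hμ : ∀ (x : X) (r : ℝ), 0 < r → 0 < μ (ball x r)) :
    μ.IsOpenPosMeasure where
  open_pos U hU := by
    rintro ⟨x, hx⟩
    obtain ⟨r, hr, hrU⟩ := Metric.isOpen_iff.1 hU x hx
    exact ((hμ x r hr).trans_le (measure_mono hrU)).ne'

theorem isLocallyFiniteMeasure_of_ball_lt_top
    (hμ : ∀ (x : X) (r : ℝ), 0 < r → μ (ball x r) < ∞) : IsLocallyFiniteMeasure μ :=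
  ⟨fun x => ⟨ball x 1, ball_mem_nhds x one_pos, hμ x 1 one_pos⟩⟩

end Doubling

section MeanOscillation

variable {α E : Type*} [MeasurableSpace α] {μ : Measure α} [NormedAddCommGroup E]
  [NormedSpace ℝ E]

/-- The mean oscillation `⨍ y in s, ‖f y - f_s‖ ∂μ` of `f` on `s`, where `f_s` is the average of `f`
on `s`; it is the left-hand side of the Poincaré inequality. -/
noncomputable def meanOscillation (μ : Measure α) (f : α → E) (s : Set α) : ℝ :=
  ⨍ y in s, ‖f y - ⨍ z in s, f z ∂μ‖ ∂μ

theorem norm_setAverage_sub_le [CompleteSpace E] {f : α → E} {s : Set α} (hs₀ : μ s ≠ 0)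
    (hs : μ s ≠ ∞) (hf : IntegrableOn f s μ) (c : E) :
    ‖(⨍ y in s, f y ∂μ) - c‖ ≤ ⨍ y in s, ‖f y - c‖ ∂μ := by
  simp only [← dist_eq_norm]
  refine (convexOn_univ_dist c).map_set_average_le (by fun_prop) isClosed_univ hs₀ hs
    (ae_of_all _ fun _ => mem_univ _) hf ?_
  simp only [Function.comp_def, dist_eq_norm]
  exact (hf.sub (integrableOn_const hs)).norm

theorem setAverage_le_mul_setAverage_of_subset {f : α → ℝ} {s t : Set α} {D : ℝ≥0}
    (hf₀ : ∀ y, 0 ≤ f y) (hf : IntegrableOn f t μ) (hst : s ⊆ t) (hs : μ s ≠ 0) (ht : μ t ≠ ∞)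
    (hD : μ t ≤ D * μ s) : ⨍ y in s, f y ∂μ ≤ D * ⨍ y in t, f y ∂μ := by
  have hs_pos : 0 < μ.real s := ENNReal.toReal_pos hs (measure_ne_top_of_subset hst ht)
  have ht_pos : 0 < μ.real t := hs_pos.trans_le (measureReal_mono hst ht)
  have hD_real : μ.real t ≤ D * μ.real s := by
    simpa [Measure.real] using
      ENNReal.toReal_mono (ENNReal.mul_ne_top (by finiteness) (measure_ne_top_of_subset hst ht)) hD
  simp only [setAverage_eq, smul_eq_mul]
  rw [inv_mul_le_iff₀ hs_pos]
  calc ∫ y in s, f y ∂μ ≤ ∫ y in t, f y ∂μ :=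
        setIntegral_mono_set hf (ae_of_all _ hf₀) hst.eventuallyLE
    _ = μ.real t * ((μ.real t)⁻¹ * ∫ y in t, f y ∂μ) := by field_simp
    _ ≤ D * μ.real s * ((μ.real t)⁻¹ * ∫ y in t, f y ∂μ) := by
        gcongr
        exact mul_nonneg (by positivity) (integral_nonneg hf₀)
    _ = μ.real s * (D * ((μ.real t)⁻¹ * ∫ y in t, f y ∂μ)) := by ring

theorem norm_setAverage_sub_setAverage_le_of_subset [CompleteSpace E] {f : α → E} {s t : Set α}
    {D : ℝ≥0} (hf : IntegrableOn f t μ) (hst : s ⊆ t) (hs : μ s ≠ 0) (ht : μ t ≠ ∞)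
    (hD : μ t ≤ D * μ s) :
    ‖(⨍ y in s, f y ∂μ) - ⨍ y in t, f y ∂μ‖ ≤ D * meanOscillation μ f t :=
  (norm_setAverage_sub_le hs (measure_ne_top_of_subset hst ht) (hf.mono_set hst) _).trans
    (setAverage_le_mul_setAverage_of_subset (fun _ => norm_nonneg _)
      (hf.sub (integrableOn_const ht)).norm hst hs ht hD)

theorem tendsto_setAverage_ball [PseudoMetricSpace α] [μ.IsOpenPosMeasure]
    [IsLocallyFiniteMeasure μ] [OpensMeasurableSpace α] [CompleteSpace E] {f : α → E} {x : α}
    (hf : ContinuousAt f x) (hint : IntegrableAtFilter f (𝓝 x) μ) :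
    Tendsto (fun r => ⨍ y in ball x r, f y ∂μ) (𝓝[>] 0) (𝓝 (f x)) := by
  rw [nhds_basis_closedBall.tendsto_right_iff]
  intro ε hε
  obtain ⟨s, hs, hfs⟩ := hint
  obtain ⟨t, ht, hμt⟩ := μ.finiteAt_nhds x
  obtain ⟨δ, hδ, hball⟩ := Metric.mem_nhds_iff.1
    (inter_mem (inter_mem hs ht) (hf (closedBall_mem_nhds (f x) hε)))
  filter_upwards [Ioo_mem_nhdsGT hδ] with r hr
  have hsub : ball x r ⊆ (s ∩ t) ∩ f ⁻¹' closedBall (f x) ε :=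
    (ball_subset_ball hr.2.le).trans hball
  refine (convex_closedBall (f x) ε).set_average_mem isClosed_closedBall
    (measure_ball_pos μ x hr.1).ne' (measure_ne_top_of_subset (fun y hy => (hsub hy).1.2) hμt.ne)
    ?_ (hfs.mono_set fun y hy => (hsub hy).1.1)
  exact ae_restrict_of_forall_mem measurableSet_ball fun y hy => (hsub hy).2

end MeanOscillation

section Campanato

theorem dist_le_of_dist_half_le {E : Type*} [PseudoMetricSpace E] {f : ℝ → E} {b : E} {K r : ℝ}
    (hr : 0 < r) (hlim : Tendsto f (𝓝[>] 0) (𝓝 b))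
    (hhalf : ∀ s, 0 < s → dist (f (s / 2)) (f s) ≤ K * s) : dist (f r) b ≤ 2 * (K * r) := by
  have hzero : Tendsto (fun n : ℕ => r / 2 ^ n) atTop (𝓝[>] 0) :=
    tendsto_nhdsWithin_iff.2
      ⟨tendsto_const_nhds.div_atTop (tendsto_pow_atTop_atTop_of_one_lt one_lt_two),
        Eventually.of_forall fun n => by simp only [mem_Ioi]; positivity⟩
  have hgeom : ∀ n : ℕ, dist (f (r / 2 ^ n)) (f (r / 2 ^ (n + 1))) ≤ 2 * (K * r) / 2 / 2 ^ n := by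
    intro n
    rw [dist_comm, pow_succ, ← div_div]
    exact (hhalf _ (by positivity)).trans_eq (by ring)
  simpa using dist_le_of_le_geometric_two_of_tendsto₀ hgeom (hlim.comp hzero)

/-- Campanato's argument, with `a x r` in the role of the average of `u` over `ball x r`. -/
theorem lipschitzWith_of_dist_half_ball_le {X E : Type*} [MetricSpace X] [PseudoMetricSpace E]
    {u : X → E} {a : X → ℝ → E} {K : ℝ≥0} (hlim : ∀ x, Tendsto (a x) (𝓝[>] 0) (𝓝 (u x)))
    (hhalf : ∀ x y r, 0 < r → ball y (r / 2) ⊆ ball x r → dist (a y (r / 2)) (a x r) ≤ K * r) :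
    LipschitzWith (8 * K) u := by
  have hpoint : ∀ (x : X) {r : ℝ}, 0 < r → dist (a x r) (u x) ≤ 2 * (K * r) := fun x r hr =>
    dist_le_of_dist_half_le hr (hlim x) fun s hs =>
      hhalf x x s hs (ball_subset_ball (half_le_self hs.le))
  refine LipschitzWith.of_dist_le_mul fun x y => ?_
  rcases eq_or_ne x y with rfl | hxy
  · simp
  set d := dist x y
  have hd : 0 < d := dist_pos.2 hxy
  have hneighbour : dist (a x (2 * d)) (a y d) ≤ K * (2 * d) := by
    have hsub : ball y (2 * d / 2) ⊆ ball x (2 * d) :=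
      ball_subset_ball' (by rw [dist_comm y x]; linarith)
    simpa [dist_comm] using hhalf x y (2 * d) (by positivity) hsub
  calc dist (u x) (u y) ≤ dist (u x) (a x (2 * d)) + dist (a x (2 * d)) (a y d)
        + dist (a y d) (u y) := dist_triangle4 _ _ _ _
    _ ≤ 2 * (K * (2 * d)) + K * (2 * d) + 2 * (K * d) := by
        gcongr
        · rw [dist_comm]; exact hpoint x (by positivity)
        · exact hpoint y hd
    _ = ↑(8 * K) * d := by push_cast; ring

variable {X E : Type*} [MetricSpace X] [MeasurableSpace X] {μ : Measure X} [μ.IsOpenPosMeasure]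
  [IsLocallyFiniteMeasure μ] [NormedAddCommGroup E] [NormedSpace ℝ E] [CompleteSpace E]

theorem IsDoubling.exists_norm_setAverage_ball_sub_le (h : IsDoubling μ) :
    ∃ D : ℝ≥0, ∀ {u : X → E} {x y : X} {r : ℝ}, IntegrableOn u (ball x r) μ → 0 < r →
      ball y (r / 2) ⊆ ball x r →
      ‖(⨍ z in ball y (r / 2), u z ∂μ) - ⨍ z in ball x r, u z ∂μ‖
        ≤ D * meanOscillation μ u (ball x r) := by
  obtain ⟨D, hD⟩ := h.exists_measure_ball_two_pow_mul_le
  refine ⟨D ^ 2, fun {u x y r} hu hr hsub => ?_⟩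
  have hyx : dist y x < r := hsub (mem_ball_self (half_pos hr))
  have hle : μ (ball x r) ≤ (D ^ 2 : ℝ≥0) * μ (ball y (r / 2)) := by
    push_cast
    refine (measure_mono (ball_subset_ball' ?_)).trans (hD 2 y (r / 2) (half_pos hr))
    rw [dist_comm]
    linarith
  exact norm_setAverage_sub_setAverage_le_of_subset hu hsub
    (measure_ball_pos μ y (half_pos hr)).ne' (h.measure_ball_lt_top x r).ne hle

theorem IsDoubling.exists_lipschitzWith_of_meanOscillation_le [OpensMeasurableSpace X]
    (h : IsDoubling μ) :
    ∃ A : ℝ≥0, ∀ (u : X → E) (C : ℝ≥0), Continuous u →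
      (∀ x r, IntegrableOn u (ball x r) μ) →
      (∀ x r, 0 < r → meanOscillation μ u (ball x r) ≤ C * r) → LipschitzWith (A * C) u := by
  obtain ⟨D, hD⟩ := h.exists_norm_setAverage_ball_sub_le (E := E)
  refine ⟨8 * D, fun u C hcont hint hosc => ?_⟩
  rw [mul_assoc]
  refine lipschitzWith_of_dist_half_ball_le
    (fun x => tendsto_setAverage_ball hcont.continuousAt ⟨_, ball_mem_nhds x one_pos, hint x 1⟩)
    fun x y r hr hsub => ?_
  rw [dist_eq_norm, NNReal.coe_mul, mul_assoc]
  exact (hD (hint x r) hr hsub).trans (by gcongr; exact hosc x r hr)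

end Campanato

section LipschitzAtScale

variable {α β V : Type*} [PseudoMetricSpace α] [PseudoMetricSpace β] [SeminormedAddCommGroup V]
  [NormedSpace ℝ V] {K : ℝ≥0} {ε : ℝ}

/-- `f` satisfies the `K`-Lipschitz condition at pairs of points at distance less than `ε`. Bounded
functions of this kind are the test functions for the Poincaré inequality; they need not be
`K`-Lipschitz on `α`, but they are along every curve. -/
def LipschitzAtScale (K : ℝ≥0) (ε : ℝ) (f : α → β) : Prop :=
  ∀ x y, dist x y < ε → dist (f x) (f y) ≤ K * dist x y

theorem LipschitzAtScale.continuous {f : α → β} (hf : LipschitzAtScale K ε f) (hε : 0 < ε) :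
    Continuous f := by
  refine continuous_iff_continuousAt.2 fun x => ?_
  refine tendsto_iff_dist_tendsto_zero.2 (squeeze_zero' (Eventually.of_forall fun _ => dist_nonneg)
    (eventually_of_mem (ball_mem_nhds x hε) fun y hy => hf y x hy) ?_)
  exact Continuous.tendsto' (by fun_prop) _ _ (by simp)

theorem LipschitzAtScale.comp_lipschitzWith_one {γ : Type*} [PseudoMetricSpace γ] {f : α → β}
    {g : γ → α} (hf : LipschitzAtScale K ε f) (hg : LipschitzWith 1 g) :
    LipschitzAtScale K ε (f ∘ g) := fun x y hxy => by
  have hgxy : dist (g x) (g y) ≤ dist x y := by simpa using hg.dist_le_mul x y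
  exact (hf _ _ (hgxy.trans_lt hxy)).trans (by gcongr)

theorem LipschitzAtScale.two_mul {f : V → β} (hf : LipschitzAtScale K ε f) :
    LipschitzAtScale K (2 * ε) f := fun x y hxy => by
  have hx : dist x (midpoint ℝ x y) = dist x y / 2 := by
    rw [dist_left_midpoint, Real.norm_ofNat, inv_mul_eq_div]
  have hy : dist (midpoint ℝ x y) y = dist x y / 2 := by
    rw [dist_midpoint_right, Real.norm_ofNat, inv_mul_eq_div]
  calc dist (f x) (f y) ≤ dist (f x) (f (midpoint ℝ x y)) + dist (f (midpoint ℝ x y)) (f y) :=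
        dist_triangle _ _ _
    _ ≤ K * dist x (midpoint ℝ x y) + K * dist (midpoint ℝ x y) y :=
        add_le_add (hf _ _ (by linarith)) (hf _ _ (by linarith))
    _ = K * dist x y := by rw [hx, hy]; ring

theorem LipschitzAtScale.lipschitzWith {f : V → β} (hf : LipschitzAtScale K ε f) (hε : 0 < ε) :
    LipschitzWith K f := by
  have hiterate : ∀ n : ℕ, LipschitzAtScale K (2 ^ n * ε) f := by
    intro n
    induction n with
    | zero => simpa using hf
    | succ n ih => rw [pow_succ', mul_assoc]; exact ih.two_mul
  refine LipschitzWith.of_dist_le_mul fun x y => ?_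
  obtain ⟨n, hn⟩ := pow_unbounded_of_one_lt (dist x y / ε) one_lt_two
  exact hiterate n x y ((div_lt_iff₀ hε).1 hn)

end LipschitzAtScale

section Curves

variable {X : Type*} [MetricSpace X]

theorem RectCurve.lipschitzOnWith (γ : RectCurve X) :
    LipschitzOnWith 1 γ.toFun (Icc 0 γ.length) := by
  refine LipschitzOnWith.of_dist_le_mul fun s hs t ht => ?_
  wlog hst : s ≤ t generalizing s t
  · rw [dist_comm, dist_comm s]
    exact this t ht s hs (le_of_not_ge hst)
  have hvar : edist (γ.toFun s) (γ.toFun t) ≤ ENNReal.ofReal (1 * (t - s)) :=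
    (eVariationOn.edist_le _ (mem_inter hs (left_mem_Icc.2 hst))
      (mem_inter ht (right_mem_Icc.2 hst))).trans_eq (γ.unitSpeed hs ht)
  rw [edist_dist, ENNReal.ofReal_le_ofReal_iff (by linarith)] at hvar
  rwa [dist_comm s t, Real.dist_eq, abs_of_nonneg (sub_nonneg.2 hst)]

/-- A curve made constant on each of the two half-lines outside `[0, l]`. Unlike `γ.toFun`, it is
Lipschitz on all of `ℝ`. -/
noncomputable def RectCurve.extend (γ : RectCurve X) : ℝ → X :=
  IccExtend γ.length_pos.le ((Icc 0 γ.length).domRestrict γ.toFun)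

theorem RectCurve.extend_of_mem (γ : RectCurve X) {t : ℝ} (ht : t ∈ Icc 0 γ.length) :
    γ.extend t = γ.toFun t :=
  IccExtend_of_mem _ _ ht

theorem RectCurve.lipschitzWith_extend (γ : RectCurve X) : LipschitzWith 1 γ.extend := by
  simpa only [mul_one] using!
    γ.lipschitzOnWith.to_restrict.comp (LipschitzWith.projIcc γ.length_pos.le)

theorem RectCurve.extend_zero (γ : RectCurve X) : γ.extend 0 = γ.source :=
  γ.extend_of_mem (left_mem_Icc.2 γ.length_pos.le)

theorem RectCurve.extend_length (γ : RectCurve X) : γ.extend γ.length = γ.target :=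
  γ.extend_of_mem (right_mem_Icc.2 γ.length_pos.le)

theorem RectCurve.integral_eq_lintegral_extend (γ : RectCurve X) (g : X → ℝ≥0∞) :
    γ.integral g = ∫⁻ t in Icc 0 γ.length, g (γ.extend t) :=
  setLIntegral_congr_fun measurableSet_Icc fun t ht => by simp only [γ.extend_of_mem ht]

variable [MeasurableSpace X] [BorelSpace X] {ε : ℝ}

theorem RectCurve.measurable_extend (γ : RectCurve X) : Measurable γ.extend :=
  γ.lipschitzWith_extend.continuous.measurable

theorem RectCurve.integral_indicator_one (γ : RectCurve X) {A : Set X} (hA : MeasurableSet A) :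
    γ.integral (A.indicator 1) = volume (Icc 0 γ.length ∩ γ.extend ⁻¹' A) := by
  rw [γ.integral_eq_lintegral_extend, inter_comm, ← Measure.restrict_apply' measurableSet_Icc,
    ← lintegral_indicator_one (γ.measurable_extend hA)]
  rfl

/-- Along a curve, `h` takes every value in `S`, and it does so at unit speed at most. -/
theorem RectCurve.volume_le_integral_indicator (γ : RectCurve X) {h : X → ℝ} {A : Set X}
    {S : Set ℝ} (hh : LipschitzAtScale 1 ε h) (hε : 0 < ε) (hA : MeasurableSet A)
    (hS : S ⊆ uIcc (h γ.source) (h γ.target)) (hSA : h ⁻¹' S ⊆ A) :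
    volume S ≤ γ.integral (A.indicator 1) := by
  have hlip : LipschitzWith 1 (h ∘ γ.extend) :=
    (hh.comp_lipschitzWith_one γ.lipschitzWith_extend).lipschitzWith hε
  have himage : S ⊆ (h ∘ γ.extend) '' (Icc 0 γ.length ∩ γ.extend ⁻¹' A) := by
    intro s hs
    have hvalue := intermediate_value_uIcc (a := 0) (b := γ.length) hlip.continuous.continuousOn
    rw [Function.comp_apply, Function.comp_apply, γ.extend_zero, γ.extend_length,
      uIcc_of_le γ.length_pos.le] at hvalue
    obtain ⟨t, ht, rfl⟩ := hvalue (hS hs)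
    exact ⟨t, ⟨ht, hSA hs⟩, rfl⟩
  rw [γ.integral_indicator_one hA]
  refine (measure_mono himage).trans ?_
  simpa [hausdorffMeasure_real] using hlip.hausdorffMeasure_image_le zero_le_one _

theorem isUpperGradient_indicator_support {u : X → ℝ} (hu : LipschitzAtScale 1 ε u) (hε : 0 < ε)
    (hu₀ : ∀ x, 0 ≤ u x) :
    IsUpperGradient ((Function.support u).indicator 1) (fun x => (u x : EReal)) := by
  have hsupp : MeasurableSet (Function.support u) :=
    measurableSet_support (hu.continuous hε).measurable
  refine ⟨measurable_one.indicator hsupp, fun γ => ⟨fun _ => ?_, fun hinfinite => ?_⟩⟩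
  · have hvolume := γ.volume_le_integral_indicator hu hε hsupp
      (S := Ioc (min (u γ.source) (u γ.target)) (max (u γ.source) (u γ.target)))
      Ioc_subset_Icc_self fun x hx => ((le_min (hu₀ _) (hu₀ _)).trans_lt hx.1).ne'
    rwa [Real.volume_Ioc, max_sub_min_eq_abs'] at hvolume
  · simp at hinfinite

theorem memNewtonian_of_lipschitzAtScale {μ : Measure X} {p : ℝ} (hp : 0 < p) {u : X → ℝ}
    {M : ℝ} (hu : LipschitzAtScale 1 ε u) (hε : 0 < ε) (huM : ∀ x, u x ∈ Icc 0 M)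
    (hμ : μ (Function.support u) < ∞) : MemNewtonian μ p (fun x => (u x : EReal)) := by
  have hmeas : Measurable u := (hu.continuous hε).measurable
  have hsupp : MeasurableSet (Function.support u) := measurableSet_support hmeas
  refine ⟨hmeas.coe_real_ereal.aemeasurable, ENNReal.rpow_lt_top_of_nonneg (by positivity)
    (ENNReal.add_lt_top.2 ⟨?_, ?_⟩).ne⟩
  · calc ∫⁻ x, (u x : EReal).abs ^ p ∂μ
        ≤ ∫⁻ x, (Function.support u).indicator (fun _ => ENNReal.ofReal M ^ p) x ∂μ := by
          refine lintegral_mono fun x => ?_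
          by_cases hx : x ∈ Function.support u
          · rw [indicator_of_mem hx, EReal.abs_def, abs_of_nonneg (huM x).1]
            gcongr
            exact (huM x).2
          · rw [indicator_of_notMem hx, Function.notMem_support.1 hx]
            simp [hp]
      _ = ENNReal.ofReal M ^ p * μ (Function.support u) := lintegral_indicator_const hsupp _
      _ < ∞ := ENNReal.mul_lt_top (by finiteness) hμ
  · calc ⨅ (g : X → ℝ≥0∞) (_ : IsUpperGradient g fun x => (u x : EReal)), ∫⁻ x, g x ^ p ∂μ
        ≤ ∫⁻ x, (Function.support u).indicator 1 x ^ p ∂μ :=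
          iInf₂_le ((Function.support u).indicator 1)
            (isUpperGradient_indicator_support hu hε fun x => (huM x).1)
      _ = ∫⁻ x, (Function.support u).indicator 1 x ∂μ := by
          refine lintegral_congr fun x => ?_
          by_cases hx : x ∈ Function.support u <;> simp [hx, hp]
      _ = μ (Function.support u) := lintegral_indicator_one hsupp
      _ < ∞ := hμ

end Curves

section Poincare

variable {X : Type*} [MetricSpace X] [MeasurableSpace X] [BorelSpace X] {μ : Measure X} {p : ℝ}
  {u : X → ℝ} {ε M : ℝ}

theorem LipschitzAtScale.integrableOn (hu : LipschitzAtScale 1 ε u) (hε : 0 < ε)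
    (huM : ∀ x, u x ∈ Icc 0 M) {s : Set X} (hs : μ s ≠ ∞) : IntegrableOn u s μ :=
  Measure.integrableOn_of_bounded (M := M) hs (hu.continuous hε).measurable.aestronglyMeasurable
    (ae_of_all _ fun x => (Real.norm_of_nonneg (huM x).1).trans_le (huM x).2)

theorem SupportsPoincare.exists_meanOscillation_le [μ.IsOpenPosMeasure] (hPI : SupportsPoincare μ p)
    (hp : 0 < p) (hball : ∀ x r, μ (ball x r) < ∞) :
    ∃ C : ℝ≥0, ∀ {u : X → ℝ} {ε M : ℝ}, LipschitzAtScale 1 ε u → 0 < ε → (∀ x, u x ∈ Icc 0 M) →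
      μ (Function.support u) < ∞ → ∀ x r, 0 < r → meanOscillation μ u (ball x r) ≤ C * r := by
  obtain ⟨C, lam, hC, hlam, hPI⟩ := hPI
  refine ⟨(C * 2).toNNReal, fun {u ε M} hu hε huM hsupp x r hr => ?_⟩
  rw [Real.coe_toNNReal _ (by positivity)]
  have hnull : ∀ {s : ℝ}, 0 < s → μ (ball x s) ≠ 0 := fun hs => (measure_ball_pos μ x hs).ne'
  have hdeviation : IntegrableOn (fun y => ‖u y - ⨍ z in ball x r, u z ∂μ‖) (ball x r) μ :=
    ((hu.integrableOn hε huM (hball x r).ne).sub (integrableOn_const (hball x r).ne)).norm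
  have hgradient : (⨍⁻ y in ball x (lam * r), (Function.support u).indicator 1 y ^ p ∂μ)
      ^ (1 / p) ≤ 1 := by
    refine ENNReal.rpow_le_one ?_ (by positivity)
    calc ⨍⁻ y in ball x (lam * r), (Function.support u).indicator 1 y ^ p ∂μ
        ≤ ⨍⁻ _ in ball x (lam * r), 1 ∂μ := by
          refine lintegral_mono fun y => ENNReal.rpow_le_one ?_ hp.le
          exact indicator_le_self' (fun _ _ => zero_le_one) y
      _ = 1 := setLAverage_one (hnull (by positivity)) (hball x _).ne
  have hdiam : C * diam (ball x r) ≤ C * 2 * r := by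
    rw [mul_assoc]
    gcongr
    exact diam_ball hr.le
  have hinequality := hPI x r hr _ (memNewtonian_of_lipschitzAtScale hp hu hε huM hsupp) _
    (isUpperGradient_indicator_support hu hε fun y => (huM y).1)
  simp only [EReal.toReal_coe] at hinequality
  rw [← ENNReal.ofReal_le_ofReal_iff (by positivity), meanOscillation,
    ofReal_setAverage hdeviation (ae_of_all _ fun y => norm_nonneg _), ← setLAverage_eq]
  calc ⨍⁻ y in ball x r, ENNReal.ofReal ‖u y - ⨍ z in ball x r, u z ∂μ‖ ∂μ
      ≤ ENNReal.ofReal (C * diam (ball x r)) *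
          (⨍⁻ y in ball x (lam * r), (Function.support u).indicator 1 y ^ p ∂μ) ^ (1 / p) :=
        hinequality
    _ ≤ ENNReal.ofReal (C * 2 * r) * 1 := by gcongr
    _ = ENNReal.ofReal (C * 2 * r) := mul_one _

theorem SupportsPoincare.exists_lipschitzWith [μ.IsOpenPosMeasure] [IsLocallyFiniteMeasure μ]
    (hPI : SupportsPoincare μ p) (hdoubling : IsDoubling μ) (hp : 0 < p) :
    ∃ L : ℝ≥0, ∀ {u : X → ℝ} {ε M : ℝ}, LipschitzAtScale 1 ε u → 0 < ε → (∀ x, u x ∈ Icc 0 M) →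
      μ (Function.support u) < ∞ → LipschitzWith L u := by
  have hball := hdoubling.measure_ball_lt_top
  obtain ⟨C, hC⟩ := hPI.exists_meanOscillation_le hp hball
  obtain ⟨A, hA⟩ := hdoubling.exists_lipschitzWith_of_meanOscillation_le (E := ℝ)
  exact ⟨A * C, fun hu hε huM hsupp => hA _ C (hu.continuous hε)
    (fun x r => hu.integrableOn hε huM (hball x r).ne) (hC hu hε huM hsupp)⟩

end Poincare

section StepChain

variable {X : Type*} [MetricSpace X] {ε : ℝ} {x y z : X} {l : ℝ≥0}

/-- `StepChain ε x y l` says that some finite chain of points leads from `x` to `y` with steps of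
length less than `ε` and total length `l`. -/
inductive StepChain (ε : ℝ) (x : X) : X → ℝ≥0 → Prop
  | refl : StepChain ε x x 0
  | step {y z : X} {l : ℝ≥0} : StepChain ε x y l → dist y z < ε → StepChain ε x z (l + nndist y z)

/-- The infimum of the lengths of the chains from `x` to `y` with steps of length less than `ε`,
with value `∞` if there is none. Bounding it by a multiple of the distance, uniformly in `ε`, yields
curves in the limit. -/
noncomputable def chainEDist (ε : ℝ) (x y : X) : ℝ≥0∞ :=
  ⨅ (l : ℝ≥0) (_ : StepChain ε x y l), (l : ℝ≥0∞)

theorem StepChain.edist_le (h : StepChain ε x y l) : edist x y ≤ l := by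
  induction h with
  | refl => simp
  | @step y z l _ _ ih =>
    calc edist x z ≤ edist x y + edist y z := edist_triangle _ _ _
      _ ≤ l + edist y z := by gcongr
      _ = ↑(l + nndist y z) := by rw [edist_nndist, ENNReal.coe_add]

theorem StepChain.chainEDist_le (h : StepChain ε x y l) : chainEDist ε x y ≤ l :=
  iInf₂_le l h

theorem exists_stepChain_of_chainEDist_lt {b : ℝ≥0∞} (h : chainEDist ε x y < b) :
    ∃ l : ℝ≥0, StepChain ε x y l ∧ l < b := by
  simpa only [chainEDist, iInf_lt_iff, exists_prop] using h

theorem chainEDist_self (ε : ℝ) (x : X) : chainEDist ε x x = 0 := by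
  simpa using StepChain.refl.chainEDist_le (ε := ε) (x := x)

theorem edist_le_chainEDist (ε : ℝ) (x y : X) : edist x y ≤ chainEDist ε x y :=
  le_iInf₂ fun _ h => h.edist_le

theorem chainEDist_le_add_edist (x : X) (h : dist y z < ε) :
    chainEDist ε x z ≤ chainEDist ε x y + edist y z := by
  rw [← tsub_le_iff_right]
  refine le_iInf₂ fun l hl => tsub_le_iff_right.2 ((hl.step h).chainEDist_le.trans_eq ?_)
  rw [ENNReal.coe_add, edist_nndist]

/-- The function `M - chainEDist ε x z`, truncated below at `0`: a bounded test function
for the Poincaré inequality, supported near `x`. -/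
noncomputable def chainBump (ε : ℝ) (x : X) (M : ℝ≥0) (z : X) : ℝ :=
  (M - chainEDist ε x z).toReal

theorem chainBump_self (ε : ℝ) (x : X) (M : ℝ≥0) : chainBump ε x M x = M := by
  simp [chainBump, chainEDist_self]

theorem chainBump_mem_Icc (ε : ℝ) (x : X) (M : ℝ≥0) (z : X) : chainBump ε x M z ∈ Icc 0 (M : ℝ) :=
  ⟨ENNReal.toReal_nonneg, ENNReal.toReal_mono ENNReal.coe_ne_top tsub_le_self⟩

theorem chainEDist_lt_of_chainBump_ne_zero {M : ℝ≥0} (h : chainBump ε x M z ≠ 0) :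
    chainEDist ε x z < M := by
  contrapose! h
  simp [chainBump, tsub_eq_zero_of_le h]

theorem lipschitzAtScale_chainBump (ε : ℝ) (x : X) (M : ℝ≥0) :
    LipschitzAtScale 1 ε (chainBump ε x M) := by
  have hle : ∀ z w, dist z w < ε → chainBump ε x M z ≤ chainBump ε x M w + dist z w := by
    intro z w hzw
    have hbound : M - chainEDist ε x z ≤ M - chainEDist ε x w + edist z w := by
      rw [tsub_le_iff_right, add_assoc, add_comm (edist z w)]
      exact le_tsub_add.trans (by gcongr; exact chainEDist_le_add_edist x hzw)
    have htop : M - chainEDist ε x w ≠ ∞ := by finiteness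
    simpa only [chainBump, dist_edist, ENNReal.toReal_add htop (edist_ne_top z w)] using
      ENNReal.toReal_mono (ENNReal.add_ne_top.2 ⟨htop, edist_ne_top z w⟩) hbound
  intro z w hzw
  rw [NNReal.coe_one, one_mul, Real.dist_eq, abs_sub_le_iff]
  constructor
  · linarith [hle z w hzw]
  · linarith [hle w z (by rwa [dist_comm]), dist_comm z w]

theorem support_chainBump_subset (ε : ℝ) (x : X) (M : ℝ≥0) :
    Function.support (chainBump ε x M) ⊆ ball x M := fun z hz => by
  have hlt : edist x z < M :=
    (edist_le_chainEDist ε x z).trans_lt (chainEDist_lt_of_chainBump_ne_zero hz)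
  rwa [edist_nndist, ENNReal.coe_lt_coe, ← NNReal.coe_lt_coe, coe_nndist, ← mem_ball'] at hlt

theorem SupportsPoincare.exists_chainEDist_le [MeasurableSpace X] [BorelSpace X] {μ : Measure X}
    [μ.IsOpenPosMeasure] [IsLocallyFiniteMeasure μ] {p : ℝ} (hPI : SupportsPoincare μ p)
    (hdoubling : IsDoubling μ) (hp : 0 < p) :
    ∃ L : ℝ≥0, ∀ (ε : ℝ) (x y : X), 0 < ε → chainEDist ε x y ≤ L * edist x y := by
  obtain ⟨L, hL⟩ := hPI.exists_lipschitzWith hdoubling hp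
  refine ⟨L, fun ε x y hε => ENNReal.le_of_forall_pos_le_add fun δ hδ _ => ?_⟩
  set M : ℝ≥0 := L * nndist x y + δ
  have hlip : LipschitzWith L (chainBump ε x M) :=
    hL (lipschitzAtScale_chainBump ε x M) hε (chainBump_mem_Icc ε x M)
      ((measure_mono (support_chainBump_subset ε x M)).trans_lt (hdoubling.measure_ball_lt_top x M))
  have hpos : 0 < chainBump ε x M y := by
    have hxy := hlip.dist_le_mul x y
    rw [chainBump_self] at hxy
    have hM : (M : ℝ) = L * dist x y + δ := by simp [M]
    linarith [NNReal.coe_pos.2 hδ, Real.sub_le_dist (M : ℝ) (chainBump ε x M y)]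
  refine (chainEDist_lt_of_chainBump_ne_zero hpos.ne').le.trans_eq ?_
  rw [edist_nndist, ENNReal.coe_add, ENNReal.coe_mul]

theorem StepChain.exists_coarse_curve (hε : 0 < ε) (h : StepChain ε x y l) :
    ∃ f : ℝ → X, f 0 = x ∧ (∀ t : ℝ, l ≤ t → f t = y) ∧ ∀ s t, dist (f s) (f t) ≤ dist s t + ε := by
  induction h with
  | refl => exact ⟨fun _ => x, rfl, fun _ _ => rfl, fun s t => by rw [dist_self]; positivity⟩
  | @step y z l h hyz ih =>
    obtain ⟨f, hf₀, hfl, hf⟩ := ih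
    set l' : ℝ≥0 := l + nndist y z with hl'
    refine ⟨fun t => if t < l' then f t else z, ?_, fun t ht => if_neg ht.not_gt, fun s t => ?_⟩
    · rcases eq_zero_or_pos l' with hzero | hpos
      · have hxz : edist x z ≤ 0 := by simpa [← hl', hzero] using (h.step hyz).edist_le
        simp [hzero, edist_le_zero.1 hxz]
      · simp [hpos, hf₀]
    · wlog hst : s ≤ t generalizing s t
      · rw [dist_comm, dist_comm s]
        exact this t s (le_of_not_ge hst)
      by_cases ht : t < l'
      · simpa [ht, hst.trans_lt ht] using hf s t
      by_cases hs : s < l'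
      · simp only [ht, hs, if_true, if_false]
        rcases le_total s l with hsl | hsl
        · have hfy := hf s l
          rw [hfl l le_rfl, Real.dist_eq, abs_sub_comm, abs_of_nonneg (sub_nonneg.2 hsl)] at hfy
          have hl't : l + dist y z ≤ t := by simpa [hl'] using ht
          rw [dist_comm s t, Real.dist_eq, abs_of_nonneg (sub_nonneg.2 hst)]
          linarith [dist_triangle (f s) y z, hl't]
        · rw [hfl s hsl]
          linarith [dist_nonneg (x := s) (y := t)]
      · simp only [ht, hs, if_false, dist_self]
        positivity

end StepChain

section Quasiconvexity

theorem exists_lipschitzWith_tendsto_ultrafilter {ι α X : Type*} [PseudoMetricSpace α]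
    [MetricSpace X] [ProperSpace X] (𝒰 : Ultrafilter ι) {f : ι → α → X} {δ : ι → ℝ} {K : ℝ≥0}
    {a : α} {x : X} (hf : ∀ i s t, dist (f i s) (f i t) ≤ K * dist s t + δ i)
    (hδ : Tendsto δ 𝒰 (𝓝 0)) (ha : ∀ i, f i a = x) :
    ∃ g : α → X, LipschitzWith K g ∧ ∀ t, Tendsto (f · t) 𝒰 (𝓝 (g t)) := by
  have hlimit : ∀ t, ∃ z, Tendsto (f · t) 𝒰 (𝓝 z) := by
    intro t
    have hbounded : ∀ᶠ i in 𝒰, f i t ∈ closedBall x (K * dist t a + 1) := by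
      filter_upwards [hδ.eventually_le_const one_pos] with i hi
      rw [mem_closedBall, ← ha i]
      linarith [hf i t a]
    obtain ⟨z, -, hz⟩ := (isCompact_closedBall x _).ultrafilter_le_nhds (𝒰.map (f · t))
      (le_principal_iff.2 hbounded)
    exact ⟨z, hz⟩
  choose g hg using hlimit
  refine ⟨g, LipschitzWith.of_dist_le_mul fun s t => ?_, hg⟩
  have hbound : Tendsto (fun i => K * dist s t + δ i) 𝒰 (𝓝 (K * dist s t)) := by
    simpa using hδ.const_add (K * dist s t)
  exact le_of_tendsto_of_tendsto ((hg s).dist (hg t)) hbound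
    (Eventually.of_forall fun i => hf i s t)

variable {X : Type*} [MetricSpace X] [ProperSpace X]

theorem exists_lipschitzWith_of_chainEDist_lt {x y : X} {M : ℝ≥0}
    (h : ∀ ε, 0 < ε → chainEDist ε x y < M) :
    ∃ g : ℝ → X, LipschitzWith 1 g ∧ g 0 = x ∧ g M = y := by
  have hcoarse : ∀ n : ℕ, ∃ f : ℝ → X, f 0 = x ∧ f M = y ∧
      ∀ s t, dist (f s) (f t) ≤ dist s t + 1 / ((n : ℝ) + 1) := by
    intro n
    have hn : 0 < 1 / ((n : ℝ) + 1) := by positivity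
    obtain ⟨l, hl, hlM⟩ := exists_stepChain_of_chainEDist_lt (h _ hn)
    obtain ⟨f, hf₀, hfl, hf⟩ := hl.exists_coarse_curve hn
    exact ⟨f, hf₀, hfl M (by exact_mod_cast hlM.le), hf⟩
  choose f hf₀ hfM hf using hcoarse
  obtain ⟨g, hg, hlim⟩ := exists_lipschitzWith_tendsto_ultrafilter (hyperfilter ℕ) (K := 1)
    (by simpa using hf)
    (tendsto_one_div_add_atTop_nhds_zero_nat.mono_left Nat.hyperfilter_le_atTop) hf₀
  refine ⟨g, hg, tendsto_nhds_unique (hlim 0) ?_, tendsto_nhds_unique (hlim M) ?_⟩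
  · simp only [hf₀, tendsto_const_nhds]
  · simp only [hfM, tendsto_const_nhds]

theorem joinedIn_closedBall_of_chainEDist_lt {x y : X} {M : ℝ≥0}
    (h : ∀ ε, 0 < ε → chainEDist ε x y < M) : JoinedIn (closedBall x M) x y := by
  obtain ⟨g, hg, rfl, rfl⟩ := exists_lipschitzWith_of_chainEDist_lt h
  have hpath : IsPathConnected (g '' Icc 0 (M : ℝ)) :=
    ((convex_Icc 0 (M : ℝ)).isPathConnected (nonempty_Icc.2 M.2)).image hg.continuous
  refine (hpath.joinedIn _ (mem_image_of_mem g (left_mem_Icc.2 M.2)) _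
    (mem_image_of_mem g (right_mem_Icc.2 M.2))).mono ?_
  rintro _ ⟨t, ht, rfl⟩
  have hle : dist (g t) (g 0) ≤ |t| := by simpa using hg.dist_le_mul t 0
  exact hle.trans ((abs_of_nonneg ht.1).trans_le ht.2)

theorem SupportsPoincare.locallyPathConnectedSpace [MeasurableSpace X] [BorelSpace X]
    {μ : Measure X} [μ.IsOpenPosMeasure] [IsLocallyFiniteMeasure μ] {p : ℝ}
    (hPI : SupportsPoincare μ p) (hdoubling : IsDoubling μ) (hp : 0 < p) :
    LocallyPathConnectedSpace X := by
  obtain ⟨L, hL⟩ := hPI.exists_chainEDist_le hdoubling hp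
  rw [locallyPathConnectedSpace_iff_pathComponentIn_mem_nhds]
  intro x U hU hx
  obtain ⟨r, hr, hrU⟩ := Metric.isOpen_iff.1 hU x hx
  lift r to ℝ≥0 using hr.le
  have hnear : ∀ᶠ y in 𝓝 x, L * nndist x y < r :=
    ContinuousAt.eventually_lt (by fun_prop) continuousAt_const (by simpa using hr)
  filter_upwards [hnear] with y hy
  obtain ⟨M, hLM, hMr⟩ := exists_between hy
  have hchain : ∀ ε, 0 < ε → chainEDist ε x y < M := fun ε hε =>
    (hL ε x y hε).trans_lt (by rw [edist_nndist]; exact_mod_cast hLM)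
  exact (joinedIn_closedBall_of_chainEDist_lt hchain).mono
    ((closedBall_subset_ball (by exact_mod_cast hMr)).trans hrU)

end Quasiconvexity

section PrimeChains

theorem inter_frontier_nonempty_of_isPreconnected {Y : Type*} [TopologicalSpace Y] {F G : Set Y}
    (hF : IsPreconnected F) (hFG : (F ∩ G).Nonempty) (hsub : ¬ F ⊆ G) :
    (F ∩ frontier G).Nonempty := by
  by_contra hempty
  have hfrontier : F ⊆ interior G ∪ interior Gᶜ := by
    rw [← compl_frontier_eq_union_interior]
    exact fun y hy hyG => hempty ⟨y, hy, hyG⟩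
  obtain ⟨y, hyF, hyG⟩ := hFG
  have hyint : y ∈ interior G :=
    (hfrontier hyF).resolve_right fun hy => interior_subset hy hyG
  exact hsub ((hF.subset_left_of_subset_union isOpen_interior isOpen_interior
    (disjoint_compl_right.mono interior_subset interior_subset) hfrontier
    ⟨y, hyF, hyint⟩).trans interior_subset)

variable {X : Type*} [MetricSpace X] {Ω : Set X} {x : X}

theorem Chain.antitone (c : Chain Ω) : Antitone c.sets := antitone_nat_of_succ_le c.subset

theorem Chain.exists_subset_of_meets (c : Chain Ω) (k : ℕ) :
    ∃ δ > 0, ∀ (F : Set X) (x : X), IsPreconnected F → F ⊆ Ω → F ⊆ ball x δ →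
      (F ∩ c.sets (k + 1)).Nonempty → F ⊆ c.sets k := by
  obtain ⟨δ, hδ, hsep⟩ := c.separated k
  refine ⟨δ / 2, by positivity, fun F x hF hFΩ hFx hmeet => ?_⟩
  by_contra hnot
  obtain ⟨y, hyF, hy⟩ := inter_frontier_nonempty_of_isPreconnected hF hmeet
    fun h => hnot (h.trans (c.subset k))
  obtain ⟨z, hzF, hz⟩ := inter_frontier_nonempty_of_isPreconnected hF
    (hmeet.mono (inter_subset_inter_right F (c.subset k))) hnot
  have hyz : δ ≤ dist y z := hsep y ⟨hFΩ hyF, hy⟩ z ⟨hFΩ hzF, hz⟩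
  linarith [mem_ball.1 (hFx hyF), mem_ball'.1 (hFx hzF), dist_triangle y x z]

theorem Chain.mem_frontier_of_impression_eq_singleton {c : Chain Ω} (hc : c.impression = {x}) :
    x ∈ frontier Ω :=
  c.impression_subset (hc.superset (mem_singleton x))

variable [ProperSpace X]

theorem Chain.isCompact_closure (c : Chain Ω) (k : ℕ) : IsCompact (closure (c.sets k)) :=
  (c.acceptable k).isBounded.isCompact_closure

theorem Chain.impression_nonempty (c : Chain Ω) : c.impression.Nonempty :=
  IsCompact.nonempty_iInter_of_sequence_nonempty_isCompact_isClosed _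
    (fun k => closure_mono (c.subset k))
    (fun k => (c.acceptable k).isConnected.nonempty.closure)
    (c.isCompact_closure 0) (fun _ => isClosed_closure)

theorem Chain.exists_subset_ball {c : Chain Ω} (hc : c.impression = {x}) {r : ℝ} (hr : 0 < r) :
    ∃ l, c.sets l ⊆ ball x r := by
  have hdirected : Directed (· ⊇ ·) fun k => closure (c.sets k) :=
    Antitone.directed_ge fun i j hij => closure_mono (c.antitone hij)
  have hnhds : ∀ y ∈ c.impression, ball x r ∈ 𝓝 y := by
    rw [hc]
    rintro _ rfl
    exact ball_mem_nhds _ hr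
  obtain ⟨l, hl⟩ := exists_subset_nhds_of_isCompact hdirected c.isCompact_closure hnhds
  exact ⟨l, subset_closure.trans hl⟩

theorem Chain.divides_of_forall_meets {c d : Chain Ω} (hc : c.impression = {x})
    (hmeet : ∀ k l, (c.sets l ∩ d.sets k).Nonempty) : c.Divides d := by
  intro k
  obtain ⟨δ, hδ, hd⟩ := d.exists_subset_of_meets k
  obtain ⟨l, hl⟩ := c.exists_subset_ball hc hδ
  exact ⟨l, hd _ x (c.acceptable l).isConnected.isPreconnected
    (c.acceptable l).ssubset.subset hl (hmeet (k + 1) l)⟩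

theorem Chain.Divides.symm_of_impression_eq_singleton {c d : Chain Ω} (hc : c.impression = {x})
    (h : d.Divides c) : c.Divides d := by
  refine Chain.divides_of_forall_meets hc fun k l => ?_
  obtain ⟨m, hm⟩ := h l
  obtain ⟨y, hy⟩ := (d.acceptable (max m k)).isConnected.nonempty
  exact ⟨y, hm (d.antitone (le_max_left _ _) hy), d.antitone (le_max_right _ _) hy⟩

theorem BoundaryEnd.isPrime_of_impression_eq_singleton {e : BoundaryEnd Ω}
    (he : e.impression = {x}) : e.IsPrime := by
  induction e using Quotient.inductionOn with
  | h c =>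
    rintro ⟨d⟩ hd
    exact Quotient.sound ⟨hd, Chain.Divides.symm_of_impression_eq_singleton he hd⟩

end PrimeChains

section FinitelyConnected

variable {X : Type*} [MetricSpace X] {Ω : Set X} {x : X}

theorem FinitelyConnectedAt.exists_connectedComponentIn_mem (h : FinitelyConnectedAt Ω x)
    {𝒱 : Ultrafilter X} (h𝒱 : (𝒱 : Filter X) ≤ 𝓝[Ω] x) {r : ℝ} (hr : 0 < r) :
    ∃ y ∈ ball x r ∩ Ω, connectedComponentIn (ball x r ∩ Ω) y ∈ 𝒱 := by
  obtain ⟨G, hG, hxG, hGr, hfinite⟩ := h r hr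
  have hmem : G ∩ Ω ∈ 𝒱 :=
    h𝒱 (inter_mem (mem_nhdsWithin_of_mem_nhds (hG.mem_nhds hxG)) self_mem_nhdsWithin)
  have hcover : ⋃₀ {A : Set X | ∃ y ∈ G ∩ Ω, A = connectedComponentIn (G ∩ Ω) y} ∈ 𝒱 :=
    mem_of_superset hmem fun y hy => ⟨_, ⟨y, hy, rfl⟩, mem_connectedComponentIn hy⟩
  obtain ⟨_, ⟨y, hy, rfl⟩, hA⟩ := (Ultrafilter.finite_sUnion_mem_iff hfinite).1 hcover
  exact ⟨y, ⟨hGr hy.1, hy.2⟩,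
    mem_of_superset hA (connectedComponentIn_mono y (inter_subset_inter_left _ hGr))⟩

theorem connectedComponentIn_subset_of_inter_nonempty {Y : Type*} [TopologicalSpace Y]
    {U V : Set Y} {y z : Y} (hUV : U ⊆ V)
    (hmeet : (connectedComponentIn U y ∩ connectedComponentIn V z).Nonempty) :
    connectedComponentIn U y ⊆ connectedComponentIn V z := by
  obtain ⟨w, hwU, hwV⟩ := hmeet
  rw [connectedComponentIn_eq hwU, connectedComponentIn_eq hwV]
  exact connectedComponentIn_mono w hUV

theorem iInter_closure_eq_singleton {r : ℕ → ℝ} (hr : Tendsto r atTop (𝓝 0)) {E : ℕ → Set X}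
    (hE : ∀ k, E k ⊆ ball x (r k)) (hx : ∀ k, x ∈ closure (E k)) : ⋂ k, closure (E k) = {x} := by
  refine Subset.antisymm (fun z hz => ?_) (singleton_subset_iff.2 (mem_iInter.2 hx))
  have hdist : ∀ k, dist z x ≤ r k := fun k =>
    closure_ball_subset_closedBall (closure_mono (hE k) (mem_iInter.1 hz k))
  exact dist_le_zero.1 (ge_of_tendsto' hr hdist)

section Components

variable [LocallyConnectedSpace X] (hΩ : IsOpen Ω)
include hΩ

theorem dist_eq_of_mem_frontier_connectedComponentIn {y z : X} {r : ℝ}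
    (hz : z ∈ Ω ∩ frontier (connectedComponentIn (ball x r ∩ Ω) y)) : dist z x = r := by
  have hopen : IsOpen (ball x r ∩ Ω) := isOpen_ball.inter hΩ
  refine le_antisymm ?_ (not_lt.1 fun hlt => ?_)
  · exact closure_ball_subset_closedBall
      (closure_mono ((connectedComponentIn_subset _ _).trans inter_subset_left) hz.2.1)
  · have hzmem : z ∈ connectedComponentIn (ball x r ∩ Ω) z :=
      mem_connectedComponentIn ⟨hlt, hz.1⟩
    have hmeet := mem_closure_iff.1 hz.2.1 _ hopen.connectedComponentIn hzmem
    refine hz.2.2 ?_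
    rw [hopen.connectedComponentIn.interior_eq]
    exact connectedComponentIn_subset_of_inter_nonempty Subset.rfl hmeet hzmem

/-- The chain whose `k`-th set is the component of `B(x, r k) ∩ Ω` containing `y k`. The chains
with one-point impression in a finitely connected `Ω` are obtained in this way. -/
def Chain.ofComponents (hx : x ∈ frontier Ω) {r : ℕ → ℝ} (hr : StrictAnti r)
    (hr₀ : Tendsto r atTop (𝓝 0)) (hΩr : ¬ Ω ⊆ ball x (r 0)) {y : ℕ → X}
    (hy : ∀ k, y k ∈ ball x (r k) ∩ Ω)
    (hmeet : ∀ k, (connectedComponentIn (ball x (r (k + 1)) ∩ Ω) (y (k + 1)) ∩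
      connectedComponentIn (ball x (r k) ∩ Ω) (y k)).Nonempty)
    (hclosure : ∀ k, x ∈ closure (connectedComponentIn (ball x (r k) ∩ Ω) (y k))) : Chain Ω where
  sets k := connectedComponentIn (ball x (r k) ∩ Ω) (y k)
  acceptable k :=
    { isBounded := isBounded_ball.subset
        ((connectedComponentIn_subset _ _).trans inter_subset_left)
      isConnected := isConnected_connectedComponentIn_iff.2 (hy k)
      ssubset := ⟨(connectedComponentIn_subset _ _).trans inter_subset_right, fun hsub =>
        hΩr (hsub.trans ((connectedComponentIn_subset _ _).trans
          (inter_subset_left.trans (ball_subset_ball (hr.antitone k.zero_le)))))⟩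
      meets_boundary := ⟨x, hclosure k, hx⟩ }
  subset k := connectedComponentIn_subset_of_inter_nonempty
    (inter_subset_inter_left _ (ball_subset_ball (hr k.lt_succ_self).le)) (hmeet k)
  separated k := by
    refine ⟨r k - r (k + 1), sub_pos.2 (hr k.lt_succ_self), fun z hz w hw => ?_⟩
    rw [← dist_eq_of_mem_frontier_connectedComponentIn hΩ hz,
      ← dist_eq_of_mem_frontier_connectedComponentIn hΩ hw, sub_le_iff_le_add, dist_comm z w]
    exact dist_triangle w z x
  impression_subset := by
    rw [iInter_closure_eq_singleton hr₀
      (fun k => (connectedComponentIn_subset _ _).trans inter_subset_left) hclosure]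
    exact singleton_subset_iff.2 hx

theorem FinitelyConnectedAt.exists_chain (hx : x ∈ frontier Ω) (h : FinitelyConnectedAt Ω x)
    {𝒱 : Ultrafilter X} (h𝒱 : (𝒱 : Filter X) ≤ 𝓝[Ω] x) :
    ∃ c : Chain Ω, c.impression = {x} ∧ (∀ k, IsOpen (c.sets k)) ∧ ∀ k, c.sets k ∈ 𝒱 := by
  obtain ⟨y₀, hy₀⟩ := 𝒱.nonempty_of_mem (h𝒱 self_mem_nhdsWithin)
  have hdist : 0 < dist y₀ x := dist_pos.2 fun h => hx.2 (by rwa [hΩ.interior_eq, ← h])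
  obtain ⟨r, hr, hrmem, hr₀⟩ := exists_seq_strictAnti_tendsto' hdist
  choose y hy hcomponent using fun k => h.exists_connectedComponentIn_mem h𝒱 (hrmem k).1
  have hclosure : ∀ k, x ∈ closure (connectedComponentIn (ball x (r k) ∩ Ω) (y k)) := fun k =>
    mem_closure_iff_ultrafilter.2 ⟨𝒱, hcomponent k, h𝒱.trans nhdsWithin_le_nhds⟩
  exact ⟨.ofComponents hΩ hx hr hr₀ (fun hsub => (hsub hy₀).not_ge (hrmem 0).2.le) hy
      (fun k => 𝒱.nonempty_of_mem (inter_mem (hcomponent (k + 1)) (hcomponent k))) hclosure,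
    iInter_closure_eq_singleton hr₀
      (fun k => (connectedComponentIn_subset _ _).trans inter_subset_left) hclosure,
    fun k => (isOpen_ball.inter hΩ).connectedComponentIn, hcomponent⟩

theorem FinitelyConnectedAtBoundary.exists_divides [ProperSpace X]
    (h : FinitelyConnectedAtBoundary Ω) (e : BoundaryEnd Ω) :
    ∃ (f : BoundaryEnd Ω) (x : X), f.impression = {x} ∧ f.Divides e := by
  induction e using Quotient.inductionOn with
  | h d =>
    obtain ⟨x, hx⟩ := d.impression_nonempty
    have : NeBot (⨅ k, 𝓝[d.sets k] x) :=
      iInf_neBot_of_directed'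
        (Antitone.directed_ge fun i j hij => nhdsWithin_mono x (d.antitone hij))
        fun k => mem_closure_iff_nhdsWithin_neBot.1 (mem_iInter.1 hx k)
    obtain ⟨𝒱, h𝒱⟩ := exists_ultrafilter_le (⨅ k, 𝓝[d.sets k] x)
    have hd : ∀ k, d.sets k ∈ 𝒱 := fun k => (h𝒱.trans (iInf_le _ k)) self_mem_nhdsWithin
    have hxΩ : x ∈ frontier Ω := d.impression_subset hx
    obtain ⟨c, hc, -, hmem⟩ := (h x hxΩ).exists_chain hΩ hxΩ
      ((h𝒱.trans (iInf_le _ 0)).trans (nhdsWithin_mono x (d.acceptable 0).ssubset.subset))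
    exact ⟨c.toEnd, x, hc, Chain.divides_of_forall_meets hc
      fun k l => 𝒱.nonempty_of_mem (inter_mem (hmem l) (hd k))⟩

theorem FinitelyConnectedAtBoundary.isPrime_iff [ProperSpace X]
    (h : FinitelyConnectedAtBoundary Ω) {e : BoundaryEnd Ω} :
    e.IsPrime ↔ ∃ x, e.impression = {x} := by
  refine ⟨fun he => ?_, fun ⟨x, hx⟩ => BoundaryEnd.isPrime_of_impression_eq_singleton hx⟩
  obtain ⟨f, x, hfx, hfe⟩ := h.exists_divides hΩ e
  exact ⟨x, he f hfe ▸ hfx⟩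

theorem FinitelyConnectedAtBoundary.isModPrime_iff [ProperSpace X] [MeasurableSpace X]
    (h : FinitelyConnectedAtBoundary Ω) {μ : Measure X} {p : ℝ}
    (hmod : ∀ (e : BoundaryEnd Ω) (x : X), e.impression = {x} → e.IsMod μ p)
    {e : BoundaryEnd Ω} : e.IsModPrime μ p ↔ ∃ x, e.impression = {x} := by
  refine ⟨fun he => ?_, fun ⟨x, hx⟩ =>
    ⟨hmod e x hx, fun f _ => BoundaryEnd.isPrime_of_impression_eq_singleton hx f⟩⟩
  obtain ⟨f, x, hfx, hfe⟩ := h.exists_divides hΩ e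
  exact ⟨x, he.2 f (hmod f x hfx) hfe ▸ hfx⟩

end Components

end FinitelyConnected

section Accessibility

variable {Y : Type*} [TopologicalSpace Y]

theorem exists_continuousOn_Ici_forall_mem_floor {E : ℕ → Set Y} (hE : ∀ k, E (k + 1) ⊆ E k)
    (hpath : ∀ k, IsPathConnected (E k)) :
    ∃ f : ℝ → Y, ContinuousOn f (Ici 0) ∧ ∀ t, f t ∈ E ⌊t⌋₊ := by
  choose y hy using fun k => (hpath k).nonempty
  have hjoined : ∀ k, JoinedIn (E k) (y k) (y (k + 1)) := fun k =>
    (hpath k).joinedIn _ (hy k) _ (hE k (hy (k + 1)))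
  let γ : ℕ → ℝ → Y := fun n => (hjoined n).somePath.extend
  let f : ℝ → Y := fun t => γ ⌊t⌋₊ (t - ⌊t⌋₊)
  have hpiece : ∀ n : ℕ, EqOn f (fun t => γ n (t - n)) (Icc n (n + 1)) := by
    rintro n t ⟨hnt, htn⟩
    rcases htn.lt_or_eq with hlt | rfl
    · have hfloor : ⌊t⌋₊ = n := (Nat.floor_eq_iff (n.cast_nonneg.trans hnt)).2 ⟨hnt, hlt⟩
      simp only [f, hfloor]
    · have hfloor : ⌊(n : ℝ) + 1⌋₊ = n + 1 := mod_cast Nat.floor_natCast (n + 1)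
      simp [f, hfloor, γ]
  have hlocallyFinite : LocallyFinite fun n : ℕ => Icc (n : ℝ) (n + 1) := by
    intro t
    refine ⟨Iio (t + 1), Iio_mem_nhds (lt_add_one t), (finite_Iic ⌈t + 1⌉₊).subset ?_⟩
    rintro n ⟨s, hs, hst⟩
    exact_mod_cast (hs.1.trans (le_of_lt hst)).trans (Nat.le_ceil (t + 1))
  have hcontinuous : ContinuousOn f (⋃ n : ℕ, Icc (n : ℝ) (n + 1)) :=
    hlocallyFinite.continuousOn_iUnion (fun _ => isClosed_Icc) fun n =>
      (((hjoined n).somePath.continuous_extend.comp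
        (continuous_sub_right _)).continuousOn).congr (hpiece n)
  refine ⟨f, hcontinuous.mono fun t ht => mem_iUnion.2
    ⟨⌊t⌋₊, Nat.floor_le ht, (Nat.lt_floor_add_one t).le⟩, fun t => ?_⟩
  have hrange : f t ∈ range (hjoined ⌊t⌋₊).somePath :=
    (hjoined ⌊t⌋₊).somePath.extend_range ▸ mem_range_self _
  exact (range_subset_iff.2 (hjoined ⌊t⌋₊).somePath_mem) hrange

theorem tendsto_inv_one_sub_sub_one_atTop :
    Tendsto (fun t : ℝ => (1 - t)⁻¹ - 1) (𝓝[<] 1) atTop := by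
  refine tendsto_atTop_add_const_right _ (-1) (tendsto_inv_nhdsGT_zero.comp ?_)
  refine tendsto_nhdsWithin_iff.2
    ⟨?_, eventually_mem_nhdsWithin.mono fun t ht => mem_Ioi.2 (sub_pos.2 ht)⟩
  exact ((continuous_sub_left (1 : ℝ)).tendsto' 1 0 (sub_self 1)).mono_left nhdsWithin_le_nhds

theorem exists_continuousOn_Icc_of_tendsto_atTop {f : ℝ → Y} {y : Y}
    (hf : ContinuousOn f (Ici 0)) (hlim : Tendsto f atTop (𝓝 y)) :
    ∃ γ : ℝ → Y, ContinuousOn γ (Icc 0 1) ∧ γ 1 = y ∧ ∀ t ∈ Ico (0 : ℝ) 1, γ t ∈ range f := by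
  let g : ℝ → ℝ := fun t => (1 - t)⁻¹ - 1
  have hg : ContinuousOn g (Ico 0 1) := by
    refine ContinuousOn.sub (ContinuousOn.inv₀ (by fun_prop) fun t ht => ?_) continuousOn_const
    exact (sub_pos.2 ht.2).ne'
  have hmaps : MapsTo g (Ico 0 1) (Ici 0) := fun t ht =>
    sub_nonneg.2 ((one_le_inv₀ (sub_pos.2 ht.2)).2 (sub_le_self _ ht.1))
  refine ⟨Function.update (f ∘ g) 1 y, ?_, Function.update_self .., fun t ht => ?_⟩
  · rw [continuousOn_update_iff, Icc_sdiff_right]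
    exact ⟨hf.comp hg hmaps, fun _ => (hlim.comp tendsto_inv_one_sub_sub_one_atTop).mono_left
      (nhdsWithin_mono 1 Ico_subset_Iio_self)⟩
  · rw [Function.update_of_ne ht.2.ne]
    exact mem_range_self _

theorem Chain.isAccessible {X : Type*} [MetricSpace X] [ProperSpace X] {Ω : Set X} {c : Chain Ω}
    {x : X} (hc : c.impression = {x}) (hpath : ∀ k, IsPathConnected (c.sets k)) :
    IsAccessible Ω x := by
  obtain ⟨f, hf, hmem⟩ := exists_continuousOn_Ici_forall_mem_floor c.subset hpath
  have hlim : Tendsto f atTop (𝓝 x) := by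
    refine nhds_basis_ball.tendsto_right_iff.2 fun r hr => ?_
    obtain ⟨l, hl⟩ := c.exists_subset_ball hc hr
    filter_upwards [tendsto_nat_floor_atTop.eventually_ge_atTop l] with t ht
    exact hl (c.antitone ht (hmem t))
  obtain ⟨γ, hγ, hγ₁, hγf⟩ := exists_continuousOn_Icc_of_tendsto_atTop hf hlim
  refine ⟨Chain.mem_frontier_of_impression_eq_singleton hc, γ, hγ, hγ₁, fun t ht => ?_⟩
  obtain ⟨s, hs⟩ := hγf t ht
  exact hs ▸ (c.acceptable _).ssubset.subset (hmem s)

end Accessibility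

section Modulus

theorem lintegral_sum_indicator_rpow_le {α ι : Type*} [MeasurableSpace α] (μ : Measure α) {p : ℝ}
    (hp : 0 < p) (s : Finset ι) (c : ι → ℝ≥0∞) {A : ι → Set α} (hA : ∀ j, MeasurableSet (A j))
    (hdisj : Pairwise (Function.onFun Disjoint A)) :
    ∫⁻ x, (∑ j ∈ s, (A j).indicator (fun _ => c j) x) ^ p ∂μ ≤ ∑ j ∈ s, c j ^ p * μ (A j) := by
  have hpointwise : ∀ x, (∑ j ∈ s, (A j).indicator (fun _ => c j) x) ^ p
      ≤ ∑ j ∈ s, (A j).indicator (fun _ => c j ^ p) x := by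
    intro x
    by_cases hx : ∃ j ∈ s, x ∈ A j
    · obtain ⟨j, hj, hxj⟩ := hx
      rw [Finset.sum_eq_single_of_mem j hj fun i _ hij =>
        indicator_of_notMem (disjoint_left.1 (hdisj hij.symm) hxj) _, indicator_of_mem hxj,
        ← indicator_of_mem hxj fun _ => c j ^ p]
      exact Finset.single_le_sum (f := fun i => (A i).indicator (fun _ => c i ^ p) x)
        (fun _ _ => zero_le) hj
    · push Not at hx
      rw [Finset.sum_eq_zero fun j hj => indicator_of_notMem (hx j hj) _,
        ENNReal.zero_rpow_of_pos hp]
      exact zero_le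
  calc ∫⁻ x, (∑ j ∈ s, (A j).indicator (fun _ => c j) x) ^ p ∂μ
      ≤ ∫⁻ x, ∑ j ∈ s, (A j).indicator (fun _ => c j ^ p) x ∂μ := lintegral_mono hpointwise
    _ = ∑ j ∈ s, c j ^ p * μ (A j) := by
      rw [lintegral_finsetSum _ fun j _ => measurable_const.indicator (hA j)]
      exact Finset.sum_congr rfl fun j _ => lintegral_indicator_const (hA j) _

variable {X : Type*} [MetricSpace X]

theorem curveFamily_mono {E E' F F' U U' : Set X} (hE : E ⊆ E') (hF : F ⊆ F') (hU : U ⊆ U') :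
    curveFamily E F U ⊆ curveFamily E' F' U' :=
  fun _ ⟨hγU, hγE, hγF⟩ => ⟨fun t ht => hU (hγU t ht), hE hγE, hF hγF⟩

variable [MeasurableSpace X]

theorem modulus_mono (μ : Measure X) (p : ℝ) {Γ Γ' : Set (RectCurve X)} (h : Γ ⊆ Γ') :
    modulus μ p Γ ≤ modulus μ p Γ' :=
  le_iInf₂ fun ρ hρ => iInf₂_le ρ ⟨hρ.1, fun γ hγ => hρ.2 γ (h hγ)⟩

theorem modulus_curveFamily_le_of_subset_ball (μ : Measure X) (p : ℝ) {x : X} {E K Ω : Set X}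
    {r R s : ℝ} (hE : E ⊆ ball x r) (hK : K ⊆ (ball x R)ᶜ) (hsR : s ≤ R) :
    modulus μ p (curveFamily E K Ω) ≤ modulus μ p (curveFamily (ball x r) (ball x s)ᶜ univ) :=
  modulus_mono μ p (curveFamily_mono hE
    (hK.trans (compl_subset_compl.2 (ball_subset_ball hsR))) (subset_univ Ω))

theorem exists_measure_ball_le_of_mem_dimensionSet {μ : Measure X} [μ.IsOpenPosMeasure]
    [IsLocallyFiniteMeasure μ] {x : X} {q : ℝ} (hq : q ∈ dimensionSet μ x) :
    ∃ K > 0, ∃ R > 0, ∀ r, 0 < r → r ≤ R → μ (ball x r) ≤ ENNReal.ofReal (K * r ^ q) := by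
  obtain ⟨-, C, R₀, hC, hR₀, hdecay⟩ := hq
  obtain ⟨U, hU, hμU⟩ := μ.finiteAt_nhds x
  obtain ⟨R₁, hR₁, hRU⟩ := Metric.mem_nhds_iff.1 hU
  have hR : 0 < min R₀ R₁ := lt_min hR₀ hR₁
  have hfinite : ∀ r ≤ min R₀ R₁, μ (ball x r) ≠ ∞ := fun r hr =>
    ((measure_mono ((ball_subset_ball (hr.trans (min_le_right _ _))).trans hRU)).trans_lt hμU).ne
  have hm : 0 < μ.real (ball x (min R₀ R₁)) :=
    ENNReal.toReal_pos (measure_ball_pos μ x hR).ne' (hfinite _ le_rfl)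
  refine ⟨C * μ.real (ball x (min R₀ R₁)) / min R₀ R₁ ^ q, by positivity, _, hR,
    fun r hr hrR => ?_⟩
  have hratio := hdecay r _ hr hrR (min_le_left _ _)
  rw [div_le_iff₀ hm, Real.div_rpow hr.le hR.le] at hratio
  rw [← ofReal_measureReal (hfinite r hrR)]
  refine ENNReal.ofReal_le_ofReal (hratio.trans_eq ?_)
  ring

theorem mem_dimensionSet_of_le {μ : Measure X} {x : X} {q q' : ℝ} (hq : q ∈ dimensionSet μ x)
    (hq'₀ : 0 < q') (hq' : q' ≤ q) : q' ∈ dimensionSet μ x := by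
  obtain ⟨-, C, R₀, hC, hR₀, hdecay⟩ := hq
  refine ⟨hq'₀, C, R₀, hC, hR₀, fun r R hr hrR hR => (hdecay r R hr hrR hR).trans ?_⟩
  have hR' : 0 < R := hr.trans_le hrR
  gcongr C * ?_
  exact Real.rpow_le_rpow_of_exponent_ge (by positivity) ((div_le_one hR').2 hrR) hq'

theorem exists_mem_dimensionSet_one_lt {μ : Measure X} {x : X} (h1 : 1 ∈ dimensionSet μ x)
    (hne : dimensionSet μ x ≠ Ioc 0 1) : ∃ q ∈ dimensionSet μ x, 1 < q := by
  by_contra! hle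
  exact hne (Subset.antisymm (fun q hq => ⟨hq.1, hle q hq⟩)
    fun q hq => mem_dimensionSet_of_le h1 hq.1 hq.2)

theorem ofReal_rpow_mul_measure_ball_le {μ : Measure X} {x : X} {p q K n r : ℝ} (hn : 0 < n)
    (hr : 0 < r) (hball : μ (ball x r) ≤ ENNReal.ofReal (K * r ^ q)) :
    ENNReal.ofReal (2 / (r * n)) ^ p * μ (ball x r)
      ≤ ENNReal.ofReal (2 ^ p * K * n ^ (-p) * r ^ (q - p)) := by
  refine (mul_le_mul_right hball _).trans_eq ?_
  rw [ENNReal.ofReal_rpow_of_pos (by positivity), ← ENNReal.ofReal_mul (by positivity),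
    Real.div_rpow zero_le_two (by positivity), Real.mul_rpow hr.le hn.le, Real.rpow_neg hn.le,
    Real.rpow_sub hr]
  congr 1
  field_simp

variable [BorelSpace X]

theorem RectCurve.integral_sum_indicator {ι : Type*} (γ : RectCurve X) (s : Finset ι)
    (c : ι → ℝ≥0∞) {A : ι → Set X} (hA : ∀ j, MeasurableSet (A j)) :
    γ.integral (fun x => ∑ j ∈ s, (A j).indicator (fun _ => c j) x)
      = ∑ j ∈ s, c j * γ.integral ((A j).indicator 1) := by
  have hmeas : ∀ j, Measurable fun t => (A j).indicator (fun _ => c j) (γ.extend t) := fun j =>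
    (measurable_const.indicator (hA j)).comp γ.measurable_extend
  rw [γ.integral_eq_lintegral_extend, lintegral_finsetSum _ fun j _ => hmeas j]
  refine Finset.sum_congr rfl fun j _ => ?_
  rw [γ.integral_indicator_one (hA j), inter_comm, ← Measure.restrict_apply' measurableSet_Icc,
    ← lintegral_indicator_const (γ.measurable_extend (hA j))]
  rfl

theorem modulus_curveFamily_ball_le_sum (μ : Measure X) {p : ℝ} (hp : 0 < p) (x : X)
    {r : ℕ → ℝ} (hr : Antitone r) {N : ℕ} {c : ℕ → ℝ≥0∞}
    (hc : 1 ≤ ∑ j ∈ Finset.range N, c j * ENNReal.ofReal (r j - r (j + 1))) :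
    modulus μ p (curveFamily (ball x (r N)) (ball x (r 0))ᶜ univ)
      ≤ ∑ j ∈ Finset.range N, c j ^ p * μ (ball x (r j)) := by
  let A : ℕ → Set X := fun j => (dist · x) ⁻¹' Ico (r (j + 1)) (r j)
  have hA : ∀ j, MeasurableSet (A j) := fun j =>
    measurableSet_Ico.preimage (continuous_id.dist continuous_const).measurable
  have hdisj : Pairwise (Function.onFun Disjoint A) := fun i j hij =>
    (hr.pairwise_disjoint_on_Ico_succ hij).preimage _
  let ρ : X → ℝ≥0∞ := fun y => ∑ j ∈ Finset.range N, (A j).indicator (fun _ => c j) y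
  have hρ : Measurable ρ :=
    Finset.measurable_sum _ fun j _ => measurable_const.indicator (hA j)
  have hadmissible : ∀ γ ∈ curveFamily (ball x (r N)) (ball x (r 0))ᶜ univ,
      1 ≤ γ.integral ρ := by
    rintro γ ⟨-, hsource, htarget⟩
    rw [γ.integral_sum_indicator _ c hA]
    refine hc.trans (Finset.sum_le_sum fun j hj => mul_le_mul_right ?_ _)
    rw [← Real.volume_Ico]
    refine γ.volume_le_integral_indicator (h := (dist · x)) (ε := 1)
      (fun y z _ => (LipschitzWith.dist_left x).dist_le_mul y z) one_pos (hA j)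
      (fun s hs => Icc_subset_uIcc ⟨?_, ?_⟩) Subset.rfl
    · exact (mem_ball.1 hsource).le.trans ((hr (Finset.mem_range.1 hj)).trans hs.1)
    · exact hs.2.le.trans ((hr j.zero_le).trans (not_lt.1 htarget))
  calc modulus μ p (curveFamily (ball x (r N)) (ball x (r 0))ᶜ univ)
      ≤ ∫⁻ y, ρ y ^ p ∂μ := iInf₂_le ρ ⟨hρ, hadmissible⟩
    _ ≤ ∑ j ∈ Finset.range N, c j ^ p * μ (A j) :=
      lintegral_sum_indicator_rpow_le μ hp _ c hA hdisj
    _ ≤ ∑ j ∈ Finset.range N, c j ^ p * μ (ball x (r j)) :=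
      Finset.sum_le_sum fun j _ => mul_le_mul_right (measure_mono fun y hy => hy.2) _

variable {μ : Measure X} {x : X} {p q K s : ℝ}

theorem modulus_curveFamily_ball_le_of_measure_ball_le (hp : 0 < p) (hpq : p ≤ q) (hK : 0 ≤ K)
    (hs : 0 < s) (hball : ∀ r, 0 < r → r ≤ s → μ (ball x r) ≤ ENNReal.ofReal (K * r ^ q))
    {N : ℕ} (hN : 0 < N) :
    modulus μ p (curveFamily (ball x (s / 2 ^ N)) (ball x s)ᶜ univ)
      ≤ ENNReal.ofReal (2 ^ p * K * (N : ℝ) ^ (1 - p) * s ^ (q - p)) := by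
  have hN' : (0 : ℝ) < N := Nat.cast_pos.2 hN
  let r : ℕ → ℝ := fun j => s / 2 ^ j
  have hr : Antitone r := fun i j hij => by dsimp only [r]; gcongr; exact one_le_two
  have hr₀ : ∀ j, 0 < r j := fun j => by positivity
  have hr_zero : r 0 = s := by simp [r]
  have hrs : ∀ j, r j ≤ s := fun j => (hr j.zero_le).trans_eq hr_zero
  have hsum : ∀ a : ℝ, ∑ _j ∈ Finset.range N, ENNReal.ofReal a = ENNReal.ofReal (N * a) := by
    intro a
    rw [Finset.sum_const, Finset.card_range, nsmul_eq_mul, ENNReal.ofReal_mul hN'.le,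
      ENNReal.ofReal_natCast]
  let c : ℕ → ℝ≥0∞ := fun j => ENNReal.ofReal (2 / (r j * N))
  have hweight : ∀ j, c j * ENNReal.ofReal (r j - r (j + 1)) = ENNReal.ofReal (1 / N) := by
    intro j
    rw [← ENNReal.ofReal_mul (by have := hr₀ j; positivity)]
    congr 1
    simp only [r]
    field_simp
    ring
  have hc : 1 ≤ ∑ j ∈ Finset.range N, c j * ENNReal.ofReal (r j - r (j + 1)) := by
    simp only [hweight, hsum, mul_one_div_cancel hN'.ne', ENNReal.ofReal_one, le_refl]
  calc modulus μ p (curveFamily (ball x (s / 2 ^ N)) (ball x s)ᶜ univ)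
      ≤ ∑ j ∈ Finset.range N, c j ^ p * μ (ball x (r j)) := by
        simpa only [hr_zero] using modulus_curveFamily_ball_le_sum μ hp x hr hc
    _ ≤ ∑ j ∈ Finset.range N, ENNReal.ofReal (2 ^ p * K * (N : ℝ) ^ (-p) * s ^ (q - p)) := by
        refine Finset.sum_le_sum fun j _ => (ofReal_rpow_mul_measure_ball_le hN' (hr₀ j)
          (hball _ (hr₀ j) (hrs j))).trans ?_
        have := hr₀ j
        gcongr
        exact hrs j
    _ = ENNReal.ofReal (2 ^ p * K * (N : ℝ) ^ (1 - p) * s ^ (q - p)) := by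
        rw [hsum, sub_eq_neg_add 1, Real.rpow_add_one hN'.ne']
        ring_nf

variable [μ.IsOpenPosMeasure] [IsLocallyFiniteMeasure μ] {R : ℝ} {η : ℝ≥0∞}

theorem exists_modulus_curveFamily_ball_le_of_lt (hp : 0 < p) (hq : q ∈ dimensionSet μ x)
    (hpq : p < q) (hR : 0 < R) (hη : 0 < η) :
    ∃ r > 0, modulus μ p (curveFamily (ball x r) (ball x R)ᶜ univ) ≤ η := by
  obtain ⟨K, hK, R₀, hR₀, hball⟩ := exists_measure_ball_le_of_mem_dimensionSet hq
  have hlim : Tendsto (fun s : ℝ => ENNReal.ofReal (2 ^ p * K * s ^ (q - p))) (𝓝[>] 0)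
      (𝓝 0) := by
    have hpow : ContinuousAt (fun s : ℝ => 2 ^ p * K * s ^ (q - p)) 0 :=
      (Real.continuousAt_rpow_const _ _ (Or.inr (sub_nonneg.2 hpq.le))).const_mul _
    refine (ENNReal.tendsto_ofReal hpow.tendsto).mono_left nhdsWithin_le_nhds |>.trans_eq ?_
    simp [Real.zero_rpow (sub_pos.2 hpq).ne']
  obtain ⟨s, hsη, hs, hsR⟩ := ((hlim.eventually_le_const hη).and
    (Ioc_mem_nhdsGT (lt_min hR hR₀))).exists
  refine ⟨s / 2 ^ 1, by positivity, ?_⟩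
  calc modulus μ p (curveFamily (ball x (s / 2 ^ 1)) (ball x R)ᶜ univ)
      ≤ modulus μ p (curveFamily (ball x (s / 2 ^ 1)) (ball x s)ᶜ univ) :=
        modulus_curveFamily_le_of_subset_ball μ p Subset.rfl Subset.rfl
          (hsR.trans (min_le_left _ _))
    _ ≤ ENNReal.ofReal (2 ^ p * K * ((1 : ℕ) : ℝ) ^ (1 - p) * s ^ (q - p)) :=
        modulus_curveFamily_ball_le_of_measure_ball_le hp hpq.le hK.le hs
          (fun r hr hrs => hball r hr (hrs.trans (hsR.trans (min_le_right _ _)))) one_pos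
    _ ≤ η := by simpa using hsη

theorem exists_modulus_curveFamily_ball_le_of_one_lt (hp : 1 < p) (hpQ : p ∈ dimensionSet μ x)
    (hR : 0 < R) (hη : 0 < η) :
    ∃ r > 0, modulus μ p (curveFamily (ball x r) (ball x R)ᶜ univ) ≤ η := by
  obtain ⟨K, hK, R₀, hR₀, hball⟩ := exists_measure_ball_le_of_mem_dimensionSet hpQ
  have hlim : Tendsto (fun N : ℕ => ENNReal.ofReal (2 ^ p * K * (N : ℝ) ^ (1 - p))) atTop
      (𝓝 0) := by
    have hpow := ((tendsto_rpow_neg_atTop (sub_pos.2 hp)).comp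
      tendsto_natCast_atTop_atTop).const_mul (2 ^ p * K)
    simpa [Function.comp_def] using ENNReal.tendsto_ofReal hpow
  obtain ⟨N, hNη, hN⟩ := ((hlim.eventually_le_const hη).and (eventually_gt_atTop 0)).exists
  have hs : 0 < min R R₀ := lt_min hR hR₀
  refine ⟨min R R₀ / 2 ^ N, by positivity, ?_⟩
  calc modulus μ p (curveFamily (ball x (min R R₀ / 2 ^ N)) (ball x R)ᶜ univ)
      ≤ modulus μ p (curveFamily (ball x (min R R₀ / 2 ^ N)) (ball x (min R R₀))ᶜ univ) :=
        modulus_curveFamily_le_of_subset_ball μ p Subset.rfl Subset.rfl (min_le_left _ _)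
    _ ≤ ENNReal.ofReal (2 ^ p * K * (N : ℝ) ^ (1 - p) * min R R₀ ^ (p - p)) :=
        modulus_curveFamily_ball_le_of_measure_ball_le (one_pos.trans hp) le_rfl hK.le hs
          (fun r hr hrs => hball r hr (hrs.trans (min_le_right _ _))) hN
    _ ≤ η := by simpa using hNη

theorem exists_modulus_curveFamily_ball_le (hp : 1 ≤ p) (hpQ : p ∈ dimensionSet μ x)
    (hQ : dimensionSet μ x ≠ Ioc 0 1) (hR : 0 < R) (hη : 0 < η) :
    ∃ r > 0, modulus μ p (curveFamily (ball x r) (ball x R)ᶜ univ) ≤ η := by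
  rcases hp.eq_or_lt with rfl | hp
  · obtain ⟨q, hq, hq1⟩ := exists_mem_dimensionSet_one_lt hpQ hQ
    exact exists_modulus_curveFamily_ball_le_of_lt one_pos hq hq1 hR hη
  · exact exists_modulus_curveFamily_ball_le_of_one_lt hp hpQ hR hη

variable [ProperSpace X] {Ω : Set X}

theorem Chain.isMod_of_impression_eq_singleton (hΩ : IsOpen Ω) (hp : 1 ≤ p)
    (hpQ : p ∈ dimensionSet μ x) (hQ : dimensionSet μ x ≠ Ioc 0 1) {c : Chain Ω}
    (hc : c.impression = {x}) : c.IsMod μ p := by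
  intro K hK hKΩ
  have hxK : x ∈ Kᶜ := fun hxK => by
    have hx := Chain.mem_frontier_of_impression_eq_singleton hc
    rw [hΩ.frontier_eq] at hx
    exact hx.2 (hKΩ hxK)
  obtain ⟨R, hR, hRK⟩ := Metric.isOpen_iff.1 hK.isClosed.isOpen_compl x hxK
  refine ENNReal.tendsto_nhds_zero.2 fun η hη => ?_
  obtain ⟨r, hr, hmodulus⟩ := exists_modulus_curveFamily_ball_le hp hpQ hQ hR hη
  obtain ⟨l, hl⟩ := c.exists_subset_ball hc hr
  filter_upwards [eventually_ge_atTop l] with k hk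
  exact (modulus_curveFamily_le_of_subset_ball μ p ((c.antitone hk).trans hl)
    (subset_compl_comm.1 hRK) le_rfl).trans hmodulus

theorem BoundaryEnd.isMod_of_impression_eq_singleton (hΩ : IsOpen Ω) (hp : 1 ≤ p)
    (hQ : ∀ x ∈ frontier Ω, p ∈ dimensionSet μ x ∧ dimensionSet μ x ≠ Ioc 0 1)
    {e : BoundaryEnd Ω} (he : e.impression = {x}) : e.IsMod μ p := by
  induction e using Quotient.inductionOn with
  | h c =>
    obtain ⟨hpx, hQx⟩ := hQ x (Chain.mem_frontier_of_impression_eq_singleton he)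
    exact ⟨c, rfl, Chain.isMod_of_impression_eq_singleton hΩ hp hpx hQx he⟩

end Modulus

end PrimeEnds

theorem mainTheorem2_general {X : Type*} [MetricSpace X] [ProperSpace X]
    [LocallyPathConnectedSpace X] [MeasurableSpace X] [BorelSpace X] (μ : Measure X)
    [μ.IsOpenPosMeasure] [IsLocallyFiniteMeasure μ] (p : ℝ) (hp : 1 ≤ p)
    (Ω : Set X) (hΩopen : IsOpen Ω) (hfin : PrimeEnds.FinitelyConnectedAtBoundary Ω) :
    (∀ e ∈ PrimeEnds.primeEndBoundary Ω, ∃ x, e.impression = {x}) ∧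
    (∀ x ∈ frontier Ω,
      (∃ e ∈ PrimeEnds.primeEndBoundary Ω, e.impression = {x}) ∧ PrimeEnds.IsAccessible Ω x) ∧
    ((∀ x ∈ frontier Ω,
        p ∈ PrimeEnds.dimensionSet μ x ∧ PrimeEnds.dimensionSet μ x ≠ Set.Ioc 0 1) →
      PrimeEnds.primeEndBoundary Ω = PrimeEnds.modPrimeEndBoundary μ p Ω) := by
  refine ⟨fun e => (hfin.isPrime_iff hΩopen).1, fun x hx => ?_, fun hQ => ?_⟩
  · have : NeBot (𝓝[Ω] x) := mem_closure_iff_nhdsWithin_neBot.1 hx.1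
    obtain ⟨𝒱, h𝒱⟩ := exists_ultrafilter_le (𝓝[Ω] x)
    obtain ⟨c, hc, hopen, -⟩ := (hfin x hx).exists_chain hΩopen hx h𝒱
    have hpath : ∀ k, IsPathConnected (c.sets k) := fun k =>
      (hopen k).isConnected_iff_isPathConnected.1 (c.acceptable k).isConnected
    exact ⟨⟨c.toEnd, PrimeEnds.BoundaryEnd.isPrime_of_impression_eq_singleton hc, hc⟩,
      PrimeEnds.Chain.isAccessible hc hpath⟩
  · have hmod : ∀ (e : PrimeEnds.BoundaryEnd Ω) (x : X), e.impression = {x} → e.IsMod μ p :=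
      fun e x => PrimeEnds.BoundaryEnd.isMod_of_impression_eq_singleton hΩopen hp hQ
    ext e
    exact (hfin.isPrime_iff hΩopen).trans (hfin.isModPrime_iff hΩopen hmod).symm

theorem mainTheorem2 {X : Type*} [MetricSpace X] [CompleteSpace X] [MeasurableSpace X]
    [BorelSpace X] (μ : Measure X)
    (hμ : ∀ (x : X) (r : ℝ), 0 < r → 0 < μ (ball x r) ∧ μ (ball x r) < ⊤)
    (hdoubling : PrimeEnds.IsDoubling μ)
    (p : ℝ) (hp : 1 ≤ p) (hPI : PrimeEnds.SupportsPoincare μ p)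
    (Ω : Set X) (hΩopen : IsOpen Ω) (hΩconn : IsConnected Ω)
    (hΩbdd : Bornology.IsBounded Ω) (hΩX : Ω ≠ Set.univ)
    (hfin : PrimeEnds.FinitelyConnectedAtBoundary Ω) :
    (∀ e ∈ PrimeEnds.primeEndBoundary Ω, ∃ x, e.impression = {x}) ∧
    (∀ x ∈ frontier Ω,
      (∃ e ∈ PrimeEnds.primeEndBoundary Ω, e.impression = {x}) ∧ PrimeEnds.IsAccessible Ω x) ∧
    ((∀ x ∈ frontier Ω,
        p ∈ PrimeEnds.dimensionSet μ x ∧ PrimeEnds.dimensionSet μ x ≠ Set.Ioc 0 1) →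
      PrimeEnds.primeEndBoundary Ω = PrimeEnds.modPrimeEndBoundary μ p Ω) := by
  have : μ.IsOpenPosMeasure :=
    PrimeEnds.isOpenPosMeasure_of_ball_pos fun x r hr => (hμ x r hr).1
  have : IsLocallyFiniteMeasure μ :=
    PrimeEnds.isLocallyFiniteMeasure_of_ball_lt_top fun x r hr => (hμ x r hr).2
  have : ProperSpace X := hdoubling.properSpace
  have : LocallyPathConnectedSpace X :=
    hPI.locallyPathConnectedSpace hdoubling (zero_lt_one.trans_le hp)
  exact mainTheorem2_general μ p hp Ω hΩopen hfin
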